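/- Consider the allocation of $m$ indivisible goods to $n$ agents with additive, personalized bi-valued utilities: each agent $i$ has two values $a_i > b_i > 0$, each good $g$ has value $u_i(g) \in \{a_i, b_i\}$ for her (it is large for her if $u_i(g) = a_i$, small otherwise), and a bundle $S$ has utility $u_i(S) = \sum_{g \in S} u_i(g)$. An allocation $\mathbf{X} = (X_1, \dots, X_n)$ is a partition of the set of goods into $n$ (possibly empty) bundles. An allocation $\mathbf{X}'$ Pareto-dominates $\mathbf{X}$ if $u_i(X'_i) \ge u_i(X_i)$ for all $i$ and $u_j(X'_j) > u_j(X_j)$ for some $j$; $\mathbf{X}$ is Pareto-optimal if no allocation Pareto-dominates it. Assume that every ratio $r_i = a_i / b_i$ is an integer. The input consists of $n$, $m$, the ratios $r_1, \dots, r_n$ (written in binary), the table telling which goods are large for which agents, and an allocation $\mathbf{X}$. (1) There is a polynomial-time algorithm that decides, for every such input, whether $\mathbf{X}$ is Pareto-optimal. (2) There is a polynomial-time algorithm that finds, for every such input in which $\mathbf{X}$ is not Pareto-optimal, a Pareto-optimal allocation $\mathbf{X}'$ that Pareto-dominates $\mathbf{X}$. Here polynomial time means that the number of steps is at most a fixed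 polynomial in the bit length of the input, on a unit-cost random access machine with addition and truncated subtraction (and no multiplication), which is polynomially equivalent to a Turing machine. -/

import Mathlib

/-! ### A random access machine with unit-cost steps

The machine has registers and arrays of cells, all holding natural numbers, and while-programs as
its control structure. The arithmetic operations are addition and truncated subtraction only (in
particular no multiplication), so that in `t` steps numbers grow by at most `t` bits. This is the
textbook unit-cost random access machine; with the input size measured in bits, its polynomial
time is the polynomial time of Turing machines. -/

namespace RAM

/-- A machine state: registers, arrays, and the output written so far. A program names only
finitely many registers and arrays; the cells of an array are addressed at run time. -/
structure State where
  reg : ℕ → ℕ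
  arr : ℕ → ℕ → ℕ
  out : List ℕ

/-- Expressions: literals, registers, array cells (with a computed address), sums, truncated
differences. -/
inductive Expr where
  | lit (k : ℕ)
  | reg (x : ℕ)
  | cell (A : ℕ) (e : Expr)
  | add (e f : Expr)
  | sub (e f : Expr)

/-- The value of an expression in a state. -/
def Expr.eval (s : State) : Expr → ℕ
  | .lit k => k
  | .reg x => s.reg x
  | .cell A e => s.arr A (e.eval s)
  | .add e f => e.eval s + f.eval s
  | .sub e f => e.eval s - f.eval s

/-- The number of steps spent on evaluating an expression: one per operation. -/
def Expr.cost : Expr → ℕ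
  | .lit _ => 1
  | .reg _ => 1
  | .cell _ e => e.cost + 1
  | .add e f => e.cost + f.cost + 1
  | .sub e f => e.cost + f.cost + 1

/-- Programs. Tests succeed when the value of the expression is nonzero. -/
inductive Prog where
  | skip
  | assign (x : ℕ) (e : Expr)
  | store (A : ℕ) (addr e : Expr)
  | write (e : Expr)
  | seq (p q : Prog)
  | ite (e : Expr) (p q : Prog)
  | loop (e : Expr) (p : Prog)

/-- `Run p s t s'`: started in state `s`, the program `p` halts in state `s'` after exactly
`t` steps. -/
inductive Run : Prog → State → ℕ → State → Prop where
  | skip (s : State) : Run .skip s 1 s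
  | assign (x : ℕ) (e : Expr) (s : State) :
      Run (.assign x e) s (e.cost + 1)
        { s with reg := Function.update s.reg x (e.eval s) }
  | store (A : ℕ) (addr e : Expr) (s : State) :
      Run (.store A addr e) s (addr.cost + e.cost + 1)
        { s with
          arr := Function.update s.arr A
            (Function.update (s.arr A) (addr.eval s) (e.eval s)) }
  | write (e : Expr) (s : State) :
      Run (.write e) s (e.cost + 1) { s with out := s.out ++ [e.eval s] }
  | seq {p q : Prog} {s₁ s₂ s₃ : State} {t₁ t₂ : ℕ}
      (hp : Run p s₁ t₁ s₂) (hq : Run q s₂ t₂ s₃) :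
      Run (.seq p q) s₁ (t₁ + t₂) s₃
  | ite_true {e : Expr} {p q : Prog} {s s₁ : State} {t : ℕ}
      (he : e.eval s ≠ 0) (hp : Run p s t s₁) :
      Run (.ite e p q) s (e.cost + 1 + t) s₁
  | ite_false {e : Expr} {p q : Prog} {s s₁ : State} {t : ℕ}
      (he : e.eval s = 0) (hq : Run q s t s₁) :
      Run (.ite e p q) s (e.cost + 1 + t) s₁
  | loop_done {e : Expr} {p : Prog} {s : State} (he : e.eval s = 0) :
      Run (.loop e p) s (e.cost + 1) s
  | loop_step {e : Expr} {p : Prog} {s₁ s₂ s₃ : State} {t₁ t₂ : ℕ}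
      (he : e.eval s₁ ≠ 0) (hp : Run p s₁ t₁ s₂) (hl : Run (.loop e p) s₂ t₂ s₃) :
      Run (.loop e p) s₁ (e.cost + 1 + t₁ + t₂) s₃

/-- The initial state on input `w`: the entries of `w` are in array `0`, their number is in
register `0`, everything else is `0`, and nothing has been written. -/
def init (w : List ℕ) : State where
  reg := fun x => if x = 0 then w.length else 0
  arr := fun A k => if A = 0 then w.getD k 0 else 0
  out := []

/-- The size of an input in bits: the binary length of every entry, plus one delimiter each. -/
def bitSize (w : List ℕ) : ℕ := (w.map fun k => Nat.size k + 1).sum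

/-- The computational problem "given `q`, presented as `enc q`, output a list `w` such that
`sol q w`" can be solved in polynomial time: there are one program and one polynomial such that
on every `q` the program halts with a correct output, and the number of steps is at most the
polynomial evaluated at the bit size of the input. -/
def SolvableInPolyTime {Q : Type} (enc : Q → List ℕ) (sol : Q → List ℕ → Prop) : Prop :=
  ∃ (prog : Prog) (P : Polynomial ℕ), ∀ q : Q, ∃ (t : ℕ) (s : State),
    Run prog (init (enc q)) t s ∧ t ≤ P.eval (bitSize (enc q)) ∧ sol q s.out

open Classical in
/-- The predicate `yes` can be decided in polynomial time: answer `1` for yes, `0` for no. -/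
def DecidableInPolyTime {Q : Type} (enc : Q → List ℕ) (yes : Q → Prop) : Prop :=
  SolvableInPolyTime enc fun q w => w = [if yes q then 1 else 0]

end RAM

/-! ### Fair division with personalized bi-valued utilities -/

namespace FairDivision

/-- A fair division instance with `n` agents, `m` goods and personalized bi-valued values:
`u i g` is the value of good `g` for agent `i`, and it is one of `a i > b i > 0`. -/
structure BivaluedInstance where
  n : ℕ
  m : ℕ
  u : Fin n → Fin m → ℝ
  a : Fin n → ℝ
  b : Fin n → ℝ
  b_pos : ∀ i, 0 < b i
  b_lt_a : ∀ i, b i < a i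
  bivalued : ∀ i g, u i g = a i ∨ u i g = b i

namespace BivaluedInstance

variable (I : BivaluedInstance)

/-- An allocation (a partition of the goods into `n` possibly empty bundles), given by the owner
of each good. -/
abbrev Allocation : Type := Fin I.m → Fin I.n

variable {I}

/-- The bundle of agent `i`. -/
def Allocation.bundle (X : I.Allocation) (i : Fin I.n) : Finset (Fin I.m) :=
  Finset.univ.filter fun g => X g = i

variable (I)

/-- The additive utility of agent `i` for a set of goods. -/
def utility (i : Fin I.n) (S : Finset (Fin I.m)) : ℝ := ∑ g ∈ S, I.u i g

variable {I}

/-- `Y` Pareto-dominates `X`. -/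
def Dominates (Y X : I.Allocation) : Prop :=
  (∀ i, I.utility i (Allocation.bundle X i) ≤ I.utility i (Allocation.bundle Y i)) ∧
    ∃ j, I.utility j (Allocation.bundle X j) < I.utility j (Allocation.bundle Y j)

/-- `X` is Pareto-optimal. -/
def ParetoOptimal (X : I.Allocation) : Prop := ¬ ∃ Y : I.Allocation, Dominates Y X

end BivaluedInstance

/-- An allocation in a personalized bi-valued instance all of whose ratios `r i = a i / b i` are
integers. -/
structure IntegerRatioInput where
  I : BivaluedInstance
  r : Fin I.n → ℕ
  ratio : ∀ i, I.a i / I.b i = r i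
  X : I.Allocation

/-- An allocation as a list: the owners of the goods, in order. -/
def encodeAllocation {I : BivaluedInstance} (X : I.Allocation) : List ℕ :=
  List.ofFn fun g => (X g : ℕ)

open Classical in
/-- The input as a list of numbers: `n`, `m`, the ratios `r i`, row by row the table telling
which goods are large for which agents (`1` for large, `0` for small), and the allocation. -/
noncomputable def IntegerRatioInput.encode (q : IntegerRatioInput) : List ℕ :=
  [q.I.n, q.I.m] ++ List.ofFn q.r ++
    (List.ofFn fun i => List.ofFn fun g => if q.I.u i g = q.I.a i then 1 else 0).flatten ++
    encodeAllocation q.X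

end FairDivision

/-!
Measure the utility of agent `i` in units of her small value, so that her goods are worth `1` or
`r i`. Two observations make Pareto-optimality easy.

**Exchanges.** Say that a good `g` can be passed on to `j` if it is large for `j`, or large for some
agent who holds a large good `h` that can be passed on to `j` and who then takes `g` in exchange for
`h`. If `g` has the value `v` for its owner `i`, can be passed on to `j`, `v < r j`, and `j` has at
least `v` small goods, then passing it on and letting `j` give `v` small goods to `i` is a
Pareto-improvement: `j` gains `r j - v`, and `i` gets her `v` back, because `v` is an integer and
every good is worth at least `1`. Conversely an allocation without such a profitable exchange is
Pareto-optimal (`Table.optimal_of_no_exchange`). The number of goods that `i` needs to keep her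
utility is a convex function of the number of large goods she gets, again because `r i` is an
integer. So a dominating allocation is a solution of a separable convex minimisation over the
assignments of large goods. Local optimality gives the dual prices `Table.price`, which certify
global optimality in a few lines, without decomposing the difference of two allocations into paths
and cycles.

**Few improvements.** The bundles have at most `(m + 1) ^ 2` different values for each agent, so a
chain of Pareto-improvements has length at most `n * (m + 1) ^ 2` (`Table.rank_lt_of_dom`,
`Table.rank_le`), however large the ratios are.

A pass of `RAM.improveCmd` over all `g` and `j` therefore either proves the allocation optimal or
improves it. One pass decides, and as many passes as the cube of the input length reach an optimum
(`RAM.optimize_spec`). On the machine side, all programs are written in the language `RAM.Cmd`,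
whose only loops count up to `n`, `m` or the input length. Such a program has a functional meaning
`RAM.Cmd.exec` that invariants can be proved about, and a running time that is bounded by a
polynomial read off from its text (`RAM.Cmd.run_compile`), so that no time analysis is needed
beyond that.
-/

/-! ### Bounded-loop programs -/

namespace RAM

/-- The state with register `x` set to `v`. -/
def State.setReg (s : State) (x v : ℕ) : State := { s with reg := Function.update s.reg x v }

/-- The state with cell `k` of array `A` set to `v`. -/
def State.setCell (s : State) (A k v : ℕ) : State :=
  { s with arr := Function.update s.arr A (Function.update (s.arr A) k v) }

@[simp] theorem State.setReg_reg (s : State) (x v y : ℕ) :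
    (s.setReg x v).reg y = if y = x then v else s.reg y := by
  simp [State.setReg, Function.update_apply]

@[simp] theorem State.setReg_arr (s : State) (x v : ℕ) : (s.setReg x v).arr = s.arr := rfl

@[simp] theorem State.setReg_out (s : State) (x v : ℕ) : (s.setReg x v).out = s.out := rfl

@[simp] theorem State.setCell_reg (s : State) (A k v : ℕ) : (s.setCell A k v).reg = s.reg := rfl

@[simp] theorem State.setCell_arr (s : State) (A k v B : ℕ) :
    (s.setCell A k v).arr B = if B = A then Function.update (s.arr A) k v else s.arr B := by
  simp [State.setCell, Function.update_apply]

instance : Add Expr := ⟨.add⟩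
instance : Sub Expr := ⟨.sub⟩

@[simp] theorem Expr.eval_add (s : State) (e f : Expr) : (e + f).eval s = e.eval s + f.eval s := rfl
@[simp] theorem Expr.eval_sub (s : State) (e f : Expr) : (e - f).eval s = e.eval s - f.eval s := rfl
@[simp] theorem Expr.eval_lit (s : State) (k : ℕ) : (Expr.lit k).eval s = k := rfl
@[simp] theorem Expr.eval_reg (s : State) (x : ℕ) : (Expr.reg x).eval s = s.reg x := rfl
@[simp] theorem Expr.eval_cell (s : State) (A : ℕ) (e : Expr) :
    (Expr.cell A e).eval s = s.arr A (e.eval s) := rfl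

/-- Programs whose only loops are counting loops: `for_ x y p` runs `p` once for every value
`0, 1, …` of register `x` below the value of register `y`. -/
inductive Cmd where
  | skip
  | assign (x : ℕ) (e : Expr)
  | store (A : ℕ) (addr e : Expr)
  | write (e : Expr)
  | seq (p q : Cmd)
  | ite (e : Expr) (p q : Cmd)
  | for_ (x y : ℕ) (p : Cmd)

namespace Cmd

/-- The machine program of a bounded-loop program. -/
def compile : Cmd → Prog
  | skip => .skip
  | assign x e => .assign x e
  | store A a e => .store A a e
  | write e => .write e
  | seq p q => .seq p.compile q.compile
  | ite e p q => .ite e p.compile q.compile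
  | for_ x y p => .seq (.assign x (.lit 0)) (.loop (.sub (.reg y) (.reg x))
      (.seq p.compile (.assign x (.add (.reg x) (.lit 1)))))

/-- The state that a bounded-loop program ends in. -/
def exec : Cmd → State → State
  | skip, s => s
  | assign x e, s => s.setReg x (e.eval s)
  | store A a e, s => s.setCell A (a.eval s) (e.eval s)
  | write e, s => { s with out := s.out ++ [e.eval s] }
  | seq p q, s => q.exec (p.exec s)
  | ite e p q, s => if e.eval s = 0 then q.exec s else p.exec s
  | for_ x y p, s =>
      Nat.rec (s.setReg x 0) (fun k s' => (p.exec s').setReg x (k + 1)) (s.reg y)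

/-- Does the program write to register `z`? -/
def writesReg (z : ℕ) : Cmd → Bool
  | assign x _ => x == z
  | seq p q => p.writesReg z || q.writesReg z
  | ite _ p q => p.writesReg z || q.writesReg z
  | for_ x _ p => x == z || p.writesReg z
  | _ => false

/-- Does the program write to array `A`? -/
def writesArr (A : ℕ) : Cmd → Bool
  | store B _ _ => B == A
  | seq p q => p.writesArr A || q.writesArr A
  | ite _ p q => p.writesArr A || q.writesArr A
  | for_ _ _ p => p.writesArr A
  | _ => false

/-- Does the program write output? -/
def writesOut : Cmd → Bool
  | write _ => true
  | seq p q => p.writesOut || q.writesOut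
  | ite _ p q => p.writesOut || q.writesOut
  | for_ _ _ p => p.writesOut
  | _ => false

/-- The program leaves the registers `0`, `1`, `2` alone, the limits of its loops are among these,
and no loop body changes its own loop counter. The running time is then bounded by a polynomial
that can be read off from the text of the program, see `Cmd.bound`. -/
def ok : Cmd → Bool
  | assign x _ => 2 < x
  | seq p q => p.ok && q.ok
  | ite _ p q => p.ok && q.ok
  | for_ x y p => 2 < x && y ≤ 2 && !p.writesReg x && p.ok
  | _ => true

/-- A bound on the running time, as a polynomial in the largest loop limit. -/
noncomputable def bound : Cmd → Polynomial ℕ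
  | skip => 1
  | assign _ e => Polynomial.C (e.cost + 1)
  | store _ a e => Polynomial.C (a.cost + e.cost + 1)
  | write e => Polynomial.C (e.cost + 1)
  | seq p q => p.bound + q.bound
  | ite e p q => Polynomial.C (e.cost + 1) + p.bound + q.bound
  | for_ _ _ p => Polynomial.X * (p.bound + Polynomial.C 8) + Polynomial.C 6

/-- The states `s` and `s'` differ at most where the program writes. -/
structure Agree (c : Cmd) (s s' : State) : Prop where
  reg : ∀ z, c.writesReg z = false → s'.reg z = s.reg z
  arr : ∀ A, c.writesArr A = false → s'.arr A = s.arr A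
  out : c.writesOut = false → s'.out = s.out

theorem for_loop_agree {x y : ℕ} {p : Cmd} (hp : ∀ s, Agree p s (p.exec s)) (s : State) (k : ℕ) :
    Agree (for_ x y p) s
      (Nat.rec (s.setReg x 0) (fun k s' => (p.exec s').setReg x (k + 1)) k) := by
  induction k with
  | zero =>
    refine ⟨fun z hz => ?_, fun A _ => rfl, fun _ => rfl⟩
    simp only [writesReg, Bool.or_eq_false_iff, beq_eq_false_iff_ne] at hz
    simp [hz.1.symm]
  | succ k ih =>
    refine ⟨fun z hz => ?_, fun A hA => ?_, fun hO => ?_⟩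
    · have hz' := hz
      simp only [writesReg, Bool.or_eq_false_iff, beq_eq_false_iff_ne] at hz'
      simp only [State.setReg_reg, hz'.1.symm, if_false]
      rw [(hp _).reg z hz'.2, ih.reg z hz]
    · simp only [State.setReg_arr]
      rw [(hp _).arr A hA, ih.arr A hA]
    · simp only [State.setReg_out]
      rw [(hp _).out hO, ih.out hO]

theorem exec_agree (c : Cmd) (s : State) : Agree c s (c.exec s) := by
  induction c generalizing s with
  | skip => exact ⟨fun _ _ => rfl, fun _ _ => rfl, fun _ => rfl⟩
  | assign x e =>
    refine ⟨fun z hz => ?_, fun _ _ => rfl, fun _ => rfl⟩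
    simp only [writesReg, beq_eq_false_iff_ne] at hz
    simp [exec, hz.symm]
  | store B a e =>
    refine ⟨fun _ _ => rfl, fun A hA => ?_, fun _ => rfl⟩
    simp only [writesArr, beq_eq_false_iff_ne] at hA
    simp [exec, hA.symm]
  | write e => exact ⟨fun _ _ => rfl, fun _ _ => rfl, fun h => by simp [writesOut] at h⟩
  | seq p q hp hq =>
    refine ⟨fun z hz => ?_, fun A hA => ?_, fun hO => ?_⟩
    · simp only [writesReg, Bool.or_eq_false_iff] at hz
      rw [exec, (hq _).reg z hz.2, (hp _).reg z hz.1]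
    · simp only [writesArr, Bool.or_eq_false_iff] at hA
      rw [exec, (hq _).arr A hA.2, (hp _).arr A hA.1]
    · simp only [writesOut, Bool.or_eq_false_iff] at hO
      rw [exec, (hq _).out hO.2, (hp _).out hO.1]
  | ite e p q hp hq =>
    refine ⟨fun z hz => ?_, fun A hA => ?_, fun hO => ?_⟩
    · simp only [writesReg, Bool.or_eq_false_iff] at hz
      rw [exec]; split
      exacts [(hq _).reg z hz.2, (hp _).reg z hz.1]
    · simp only [writesArr, Bool.or_eq_false_iff] at hA
      rw [exec]; split
      exacts [(hq _).arr A hA.2, (hp _).arr A hA.1]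
    · simp only [writesOut, Bool.or_eq_false_iff] at hO
      rw [exec]; split
      exacts [(hq _).out hO.2, (hp _).out hO.1]
  | for_ x y p hp => exact for_loop_agree hp s _

/-- The invariant rule for counting loops. The step may use that the loop counter is `k` and that
whatever the loop does not write is as it was before the loop. -/
theorem exec_for_inv {x y : ℕ} {p : Cmd} (s : State) (Inv : ℕ → State → Prop)
    (h0 : Inv 0 (s.setReg x 0))
    (hstep : ∀ k s', k < s.reg y → s'.reg x = k → Agree (for_ x y p) s s' → Inv k s' →
      Inv (k + 1) ((p.exec s').setReg x (k + 1))) :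
    Inv (s.reg y) ((for_ x y p).exec s) := by
  have key : ∀ k, k ≤ s.reg y →
      Inv k (Nat.rec (s.setReg x 0) (fun k s' => (p.exec s').setReg x (k + 1)) k) := by
    intro k
    induction k with
    | zero => exact fun _ => h0
    | succ k ih =>
      intro hk
      refine hstep k _ hk ?_ (for_loop_agree (exec_agree p) s k) (ih (by omega))
      cases k <;> simp
  exact key _ le_rfl

theorem writesReg_of_ok {c : Cmd} (hc : c.ok = true) {z : ℕ} (hz : z ≤ 2) :
    c.writesReg z = false := by
  induction c with
  | assign x e =>
    simp only [ok, decide_eq_true_eq] at hc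
    simp only [writesReg, beq_eq_false_iff_ne]
    omega
  | seq p q hp hq | ite e p q hp hq =>
    simp only [ok, Bool.and_eq_true] at hc
    simp [writesReg, hp hc.1, hq hc.2]
  | for_ x y p hp =>
    simp only [ok, Bool.and_eq_true, decide_eq_true_eq] at hc
    simp only [writesReg, hp hc.2, Bool.or_false, beq_eq_false_iff_ne]
    omega
  | _ => rfl

/-- The machine program runs as `Cmd.exec` says, within the time `Cmd.bound`. -/
theorem run_compile (c : Cmd) (hc : c.ok = true) (s : State) (hs : ∀ y ≤ 2, s.reg y ≤ s.reg 0) :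
    ∃ t, Run c.compile s t (c.exec s) ∧ t ≤ c.bound.eval (s.reg 0) := by
  induction c generalizing s with
  | skip => exact ⟨1, .skip s, by simp [bound]⟩
  | assign x e => exact ⟨_, .assign x e s, by simp [bound]⟩
  | store A a e => exact ⟨_, .store A a e s, by simp [bound]⟩
  | write e => exact ⟨_, .write e s, by simp [bound]⟩
  | seq p q hp hq =>
    simp only [ok, Bool.and_eq_true] at hc
    obtain ⟨t₁, h₁, b₁⟩ := hp hc.1 s hs
    have hr : ∀ y ≤ 2, (p.exec s).reg y = s.reg y :=
      fun y hy => (exec_agree p s).reg y (writesReg_of_ok hc.1 hy)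
    obtain ⟨t₂, h₂, b₂⟩ := hq hc.2 (p.exec s) (fun y hy => by
      rw [hr y hy, hr 0 (by omega)]; exact hs y hy)
    rw [hr 0 (by omega)] at b₂
    exact ⟨_, .seq h₁ h₂, by simp only [bound, Polynomial.eval_add]; omega⟩
  | ite e p q hp hq =>
    simp only [ok, Bool.and_eq_true] at hc
    by_cases he : e.eval s = 0
    · obtain ⟨t, h, b⟩ := hq hc.2 s hs
      refine ⟨_, by simpa [exec, compile, he] using Run.ite_false he h, ?_⟩
      simp only [bound, Polynomial.eval_add, Polynomial.eval_C]; omega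
    · obtain ⟨t, h, b⟩ := hp hc.1 s hs
      refine ⟨_, by simpa [exec, compile, he] using Run.ite_true he h, ?_⟩
      simp only [bound, Polynomial.eval_add, Polynomial.eval_C]; omega
  | for_ x y p hp =>
    simp only [ok, Bool.and_eq_true, decide_eq_true_eq, Bool.not_eq_true'] at hc
    obtain ⟨⟨⟨hx, hy⟩, hxp⟩, hpo⟩ := hc
    set S : ℕ → State := fun k =>
      Nat.rec (s.setReg x 0) (fun k s' => (p.exec s').setReg x (k + 1)) k with hS
    have hSx : ∀ k, (S k).reg x = k := by intro k; cases k <;> simp [hS]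
    have hSy : ∀ k, ∀ z ≤ 2, (S k).reg z = s.reg z := fun k z hz =>
      (for_loop_agree (y := y) (exec_agree p) s k).reg z (by
        simp only [writesReg, writesReg_of_ok hpo hz, Bool.or_false, beq_eq_false_iff_ne]
        omega)
    set b := p.bound.eval (s.reg 0) with hb
    -- the last `d` rounds of the loop
    have key : ∀ d, d ≤ s.reg y → ∃ t, Run (.loop (.sub (.reg y) (.reg x))
        (.seq p.compile (.assign x (.add (.reg x) (.lit 1))))) (S (s.reg y - d)) t (S (s.reg y)) ∧
        t ≤ d * (b + 8) + 4 := by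
      intro d
      induction d with
      | zero =>
        intro _
        refine ⟨_, .loop_done ?_, by simp [Expr.cost]⟩
        simp [Expr.eval, hSx, hSy _ y hy]
      | succ d ih =>
        intro hd
        obtain ⟨t, h, ht⟩ := ih (by omega)
        set k := s.reg y - (d + 1) with hk
        have hk1 : s.reg y - d = k + 1 := by omega
        obtain ⟨t', h', ht'⟩ := hp hpo (S k) (fun z hz => by
          rw [hSy k z hz, hSy k 0 (by omega)]; exact hs z hz)
        rw [hSy k 0 (by omega), ← hb] at ht'
        have hxk : (p.exec (S k)).reg x = k := by
          rw [(exec_agree p (S k)).reg x hxp, hSx]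
        have hass := Run.assign x (.add (.reg x) (.lit 1)) (p.exec (S k))
        have hstate : ({ p.exec (S k) with
            reg := Function.update (p.exec (S k)).reg x
              (Expr.eval (p.exec (S k)) (.add (.reg x) (.lit 1))) } : State) = S (k + 1) := by
          simp only [Expr.eval, hxk]; rfl
        rw [hstate] at hass
        rw [hk1] at h
        refine ⟨_, .loop_step ?_ (.seq h' hass) h, ?_⟩
        · simp only [Expr.eval, hSx, hSy _ y hy]; omega
        · simp only [Expr.cost]
          have : (d + 1) * (b + 8) = d * (b + 8) + b + 8 := by ring
          omega
    obtain ⟨t, h, ht⟩ := key (s.reg y) le_rfl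
    rw [Nat.sub_self] at h
    refine ⟨_, .seq (.assign x (.lit 0) s) h, ?_⟩
    have := Nat.mul_le_mul_right (b + 8) (hs y hy)
    simp only [bound, Polynomial.eval_add, Polynomial.eval_mul, Polynomial.eval_X,
      Polynomial.eval_C, Expr.cost, ← hb]
    omega

end Cmd

theorem length_le_bitSize (w : List ℕ) : w.length ≤ bitSize w := by
  induction w with
  | nil => simp
  | cons a w ih => simp only [bitSize, List.map_cons, List.sum_cons, List.length_cons] at *; omega

end RAM

/-! ### The exchange criterion for Pareto-optimality -/

namespace FairDivision

/-- A bi-valued instance with agents `0, …, n - 1` and goods `0, …, m - 1`, normalised so that a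
small good is worth `1` and a large good is worth `r i` to agent `i`. Good `g` is large for agent
`i` iff `lg i g ≠ 0`. Allocations are functions `o : ℕ → ℕ`, `o g` being the owner of good `g`;
only the arguments `g < m` matter. -/
structure Table where
  n : ℕ
  m : ℕ
  r : ℕ → ℕ
  lg : ℕ → ℕ → ℕ

namespace Table

variable (T : Table)

/-- The value of good `g` for agent `i`. -/
def val (i g : ℕ) : ℕ := if T.lg i g = 0 then 1 else T.r i

/-- The utility of agent `i` in the allocation `o`. -/
def util (o : ℕ → ℕ) (i : ℕ) : ℕ := ∑ g ∈ Finset.range T.m, if o g = i then T.val i g else 0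

/-- The number of goods in the bundle of `i` that are small for her. -/
def small (o : ℕ → ℕ) (i : ℕ) : ℕ :=
  ∑ g ∈ Finset.range T.m, if o g = i ∧ T.lg i g = 0 then 1 else 0

/-- The number of goods in the bundle of `i` that are large for her. -/
def large (o : ℕ → ℕ) (i : ℕ) : ℕ :=
  ∑ g ∈ Finset.range T.m, if o g = i ∧ T.lg i g ≠ 0 then 1 else 0

/-- Every good is owned by some agent. -/
def Valid (o : ℕ → ℕ) : Prop := ∀ g < T.m, o g < T.n

/-- `o'` Pareto-dominates `o`. -/
def Dom (o' o : ℕ → ℕ) : Prop :=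
  (∀ i < T.n, T.util o i ≤ T.util o' i) ∧ ∃ j < T.n, T.util o j < T.util o' j

/-- `o` is Pareto-optimal. -/
def Optimal (o : ℕ → ℕ) : Prop := ∀ o', T.Valid o' → ¬ T.Dom o' o

/-- Good `g` can be passed on to `j` as a large good: either it is large for `j`, or some agent for
whom it is large takes it in exchange for another good that is large for her and that can be passed
on to `j`. -/
inductive Reach (o : ℕ → ℕ) (j : ℕ) : ℕ → Prop
  | base {g : ℕ} (hg : g < T.m) (h : T.lg j g ≠ 0) : Reach o j g
  | step {g h : ℕ} (hg : g < T.m) (hh : h < T.m) (hl : T.lg (o h) h ≠ 0)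
      (hlg : T.lg (o h) g ≠ 0) (hr : Reach o j h) : Reach o j g

/-- The exchange "the owner of `g` gives up `g`, which is passed on to `j`, and gets from `j` as
many small goods as `g` was worth to her" is possible and profitable for `j`. -/
def Exchange (o : ℕ → ℕ) (g j : ℕ) : Prop :=
  T.Reach o j g ∧ T.val (o g) g < T.r j ∧ T.val (o g) g ≤ T.small o j

variable {T}

theorem Reach.lt {o : ℕ → ℕ} {j g : ℕ} (h : T.Reach o j g) : g < T.m := by
  cases h <;> assumption

theorem util_eq (o : ℕ → ℕ) (i : ℕ) : T.util o i = T.r i * T.large o i + T.small o i := by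
  simp only [util, large, small, Finset.mul_sum, ← Finset.sum_add_distrib]
  refine Finset.sum_congr rfl fun g _ => ?_
  by_cases h : o g = i <;> by_cases h' : T.lg i g = 0 <;> simp [h, h', val]

theorem large_add_small (o : ℕ → ℕ) (i : ℕ) :
    T.large o i + T.small o i = ∑ g ∈ Finset.range T.m, if o g = i then 1 else 0 := by
  simp only [large, small, ← Finset.sum_add_distrib]
  refine Finset.sum_congr rfl fun g _ => ?_
  by_cases h : o g = i <;> by_cases h' : T.lg i g = 0 <;> simp [h, h']

theorem sum_owner {M : Type*} [AddCommMonoid M] {o : ℕ → ℕ} (ho : T.Valid o) (F : ℕ → ℕ → M) :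
    ∑ i ∈ Finset.range T.n, ∑ g ∈ Finset.range T.m, (if o g = i then F i g else 0) =
      ∑ g ∈ Finset.range T.m, F (o g) g := by
  rw [Finset.sum_comm]
  refine Finset.sum_congr rfl fun g hg => ?_
  rw [Finset.sum_ite_eq, if_pos (Finset.mem_range.2 (ho g (Finset.mem_range.1 hg)))]

theorem sum_card {o : ℕ → ℕ} (ho : T.Valid o) :
    ∑ i ∈ Finset.range T.n, (T.large o i + T.small o i) = T.m := by
  simp only [large_add_small]
  rw [sum_owner ho (fun _ _ => 1)]
  simp

theorem exists_of_large_pos {o : ℕ → ℕ} {i : ℕ} (h : T.large o i ≠ 0) :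
    ∃ g < T.m, o g = i ∧ T.lg i g ≠ 0 := by
  obtain ⟨g, hg, hne⟩ := Finset.exists_ne_zero_of_sum_ne_zero h
  refine ⟨g, Finset.mem_range.1 hg, ?_⟩
  by_contra hc
  exact hne (if_neg hc)

/-- Agent `j` is `i`, or one of the large goods in the bundle of `i` can be passed on to `j`. -/
def AgentReach (T : Table) (o : ℕ → ℕ) (i j : ℕ) : Prop :=
  j = i ∨ ∃ h < T.m, o h = i ∧ T.lg i h ≠ 0 ∧ T.Reach o j h

/-- With `s = T.small o j`, the change in the number of goods that `j` needs for her present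
utility when she gets one more large good, which is `1 - min r s`, minus `ε` times the utility she
then has in excess. -/
noncomputable def gain (T : Table) (o : ℕ → ℕ) (ε : ℝ) (j : ℕ) : ℝ :=
  1 - min (T.r j : ℝ) (T.small o j) - ε * max 0 ((T.r j : ℝ) - T.small o j)

open Classical in
/-- The dual price of a large good in the hands of `i`: the least gain among the agents that can be
reached from `i`, but at most `0`. -/
noncomputable def price (T : Table) (o : ℕ → ℕ) (ε : ℝ) (i : ℕ) : ℝ :=
  (insert 0 (((Finset.range T.n).filter (T.AgentReach o i)).image (T.gain o ε))).min'
    (Finset.insert_nonempty _ _)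

theorem price_nonpos (o : ℕ → ℕ) (ε : ℝ) (i : ℕ) : T.price o ε i ≤ 0 := by
  classical exact Finset.min'_le _ _ (Finset.mem_insert_self _ _)

theorem price_le_gain {o : ℕ → ℕ} (ε : ℝ) {i j : ℕ} (hj : j < T.n) (h : T.AgentReach o i j) :
    T.price o ε i ≤ T.gain o ε j := by
  classical
  refine Finset.min'_le _ _ (Finset.mem_insert_of_mem (Finset.mem_image_of_mem _ ?_))
  simp [hj, h]

theorem le_price {o : ℕ → ℕ} {ε : ℝ} {i : ℕ} {c : ℝ} (h0 : c ≤ 0)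
    (h : ∀ j < T.n, T.AgentReach o i j → c ≤ T.gain o ε j) : c ≤ T.price o ε i := by
  classical
  refine Finset.le_min' _ _ _ fun y hy => ?_
  rcases Finset.mem_insert.1 hy with rfl | hy
  · exact h0
  · obtain ⟨j, hj, rfl⟩ := Finset.mem_image.1 hy
    simp only [Finset.mem_filter, Finset.mem_range] at hj
    exact h j hj.1 hj.2

theorem AgentReach.reach {o : ℕ → ℕ} {g j k : ℕ} (hg : g < T.m) (hk : T.lg k g ≠ 0)
    (h : T.AgentReach o k j) : T.Reach o j g := by
  rcases h with rfl | ⟨h, hh, rfl, hl, hr⟩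
  · exact .base hg hk
  · exact .step hg hh hl hk hr

/-- If passing on a good of value `v` to `j` is not a profitable exchange, then the gain of `j` does
not make up for the loss of `v` that the former owner has. -/
theorem one_sub_le_gain {o : ℕ → ℕ} {ε : ℝ} {j v : ℕ} (hε : 0 ≤ ε) (hεj : ε * T.r j ≤ 1)
    (h : ¬ (v < T.r j ∧ v ≤ T.small o j)) (hv : 1 ≤ v) : 1 - (v : ℝ) ≤ T.gain o ε j := by
  have hs : (0 : ℝ) ≤ T.small o j := Nat.cast_nonneg _
  have hεs : 0 ≤ ε * T.small o j := by positivity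
  rw [gain]
  rcases le_total (T.r j : ℝ) (T.small o j) with hrs | hrs
  · rw [min_eq_left hrs, max_eq_left (by linarith)]
    have hrs' : T.r j ≤ T.small o j := by exact_mod_cast hrs
    have : T.r j ≤ v := by by_contra hlt; exact h ⟨by omega, by omega⟩
    have : (T.r j : ℝ) ≤ v := by exact_mod_cast this
    linarith
  · rw [min_eq_right hrs, max_eq_right (by linarith)]
    by_cases hvr : v < T.r j
    · have : T.small o j + 1 ≤ v := by by_contra hlt; exact h ⟨hvr, by omega⟩
      have : (T.small o j : ℝ) + 1 ≤ v := by exact_mod_cast this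
      nlinarith
    · have : (T.r j : ℝ) ≤ v := by exact_mod_cast not_lt.1 hvr
      by_cases hε1 : ε ≤ 1
      · nlinarith
      · -- `ε r ≤ 1 < ε` forces `r = 0`
        have : (T.r j : ℝ) < 1 := by nlinarith [(Nat.cast_nonneg (T.r j) : (0 : ℝ) ≤ T.r j)]
        have : T.r j = 0 := by
          have : T.r j < 1 := by exact_mod_cast this
          omega
        have : (1 : ℝ) ≤ v := by exact_mod_cast hv
        simp_all

/-- An allocation without profitable exchanges is Pareto-optimal. The prices are optimal dual
variables: they certify that no allocation in which everybody keeps her utility uses fewer than all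
the goods, or uses all the goods with some utility in excess. -/
theorem optimal_of_no_exchange {o : ℕ → ℕ} (ho : T.Valid o) (hr : ∀ i < T.n, 2 ≤ T.r i)
    (hex : ∀ g < T.m, ∀ j < T.n, ¬ T.Exchange o g j) : T.Optimal o := by
  intro y hy hdom
  -- `ε` is so small that an excess of utility never makes up for a whole good
  obtain ⟨ε, hε0, hε1, hεr⟩ : ∃ ε : ℝ, 0 < ε ∧ ε < 1 ∧ ∀ j < T.n, ε * T.r j ≤ 1 := by
    set R := ∑ j ∈ Finset.range T.n, T.r j
    refine ⟨1 / (R + 2), by positivity, ?_, fun j hj => ?_⟩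
    · rw [div_lt_one (by positivity)]
      have : (0 : ℝ) ≤ R := Nat.cast_nonneg _
      linarith
    · have : T.r j ≤ R :=
        Finset.single_le_sum (f := T.r) (fun _ _ => Nat.zero_le _) (Finset.mem_range.2 hj)
      have : (T.r j : ℝ) ≤ R := by exact_mod_cast this
      rw [one_div_mul_eq_div, div_le_one (by positivity)]
      linarith
  set π := T.price o ε with hπ
  set d : ℕ → ℝ := fun i => (T.large y i : ℝ) - T.large o i with hd
  set e : ℕ → ℝ := fun i => (T.util y i : ℝ) - T.util o i with he
  have he0 : ∀ i < T.n, 0 ≤ e i := fun i hi => by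
    have : (T.util o i : ℝ) ≤ T.util y i := by exact_mod_cast hdom.1 i hi
    simp only [he]; linarith
  -- the price is a subgradient of the number of goods that `i` needs
  have hagent : ∀ i < T.n, (π i + T.r i - 1) * d i ≤ (1 - ε) * e i := by
    intro i hi
    have hr2 : (2 : ℝ) ≤ T.r i := by exact_mod_cast hr i hi
    have hs0 : (0 : ℝ) ≤ T.small o i := Nat.cast_nonneg _
    have hs0' : (0 : ℝ) ≤ T.small y i := Nat.cast_nonneg _
    rcases le_or_gt (d i) 0 with hdi | hdi
    · have h1 : 0 ≤ (1 - ε) * e i := mul_nonneg (by linarith) (he0 i hi)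
      rcases eq_or_lt_of_le hdi with hd0 | hdneg
      · rw [hd0, mul_zero]; exact h1
      · have hlo : T.large o i ≠ 0 := by
          intro h0
          have : (0 : ℝ) ≤ T.large y i := Nat.cast_nonneg _
          simp only [hd, h0] at hdneg
          push_cast at hdneg
          linarith
        obtain ⟨g, hg, hgi, hlg⟩ := exists_of_large_pos hlo
        have hpi : 1 - (T.r i : ℝ) ≤ π i := by
          refine le_price (by linarith) fun j hj har => ?_
          refine one_sub_le_gain hε0.le (hεr j hj) ?_ (by have := hr i hi; omega)
          intro hc
          rcases har with rfl | ⟨h, hh, hoh, hlh, hrh⟩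
          · exact absurd hc.1 (lt_irrefl _)
          · refine hex h hh j hj ⟨hrh, ?_⟩
            rw [hoh]
            simpa [val, hlh] using hc
        nlinarith
    · have hd1 : 1 ≤ d i := by
        simp only [hd] at hdi ⊢
        have : T.large o i < T.large y i := by exact_mod_cast sub_pos.1 hdi
        have : (T.large o i : ℝ) + 1 ≤ T.large y i := by exact_mod_cast this
        linarith
      have hei : e i = T.r i * d i + T.small y i - T.small o i := by
        simp only [he, hd, util_eq]; push_cast; ring
      have hg := price_le_gain (T := T) (o := o) ε hi (Or.inl rfl : T.AgentReach o i i)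
      rw [← hπ, gain] at hg
      rcases le_total (T.r i : ℝ) (T.small o i) with hrs | hrs
      · rw [min_eq_left hrs, max_eq_left (by linarith)] at hg
        have h1 : 0 ≤ (1 - ε) * e i := mul_nonneg (by linarith) (he0 i hi)
        nlinarith
      · rw [min_eq_right hrs, max_eq_right (by linarith)] at hg
        have h1 : π i + T.r i - 1 ≤ (1 - ε) * (T.r i - T.small o i) := by linarith
        have h2 : (T.r i - T.small o i) * d i ≤ e i := by rw [hei]; nlinarith
        calc _ ≤ (1 - ε) * (T.r i - T.small o i) * d i :=
              mul_le_mul_of_nonneg_right h1 (by linarith)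
          _ = (1 - ε) * ((T.r i - T.small o i) * d i) := by ring
          _ ≤ _ := mul_le_mul_of_nonneg_left h2 (by linarith)
  -- the total price of the large goods is least in `o`, good by good
  have hlarge : ∀ z, T.Valid z → ∑ i ∈ Finset.range T.n, π i * T.large z i =
      ∑ g ∈ Finset.range T.m, if T.lg (z g) g = 0 then 0 else π (z g) := by
    intro z hz
    rw [← sum_owner hz (fun i g => if T.lg i g = 0 then 0 else π i)]
    refine Finset.sum_congr rfl fun i _ => ?_
    simp only [large]
    push_cast
    rw [Finset.mul_sum]
    refine Finset.sum_congr rfl fun g _ => ?_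
    by_cases h : z g = i <;> by_cases h' : T.lg i g = 0 <;> simp [h, h']
  have hprice : 0 ≤ ∑ i ∈ Finset.range T.n, π i * d i := by
    simp only [hd, mul_sub, Finset.sum_sub_distrib, hlarge y hy, hlarge o ho, sub_nonneg]
    refine Finset.sum_le_sum fun g hg => ?_
    have hg' := Finset.mem_range.1 hg
    by_cases h1 : T.lg (y g) g = 0
    · by_cases h2 : T.lg (o g) g = 0
      · simp [h1, h2]
      · simpa [h1, h2] using price_nonpos o ε (o g)
    · by_cases h2 : T.lg (o g) g = 0
      · simp only [h1, h2, if_true, if_false]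
        refine le_price le_rfl fun j hj har => ?_
        have h3 := one_sub_le_gain (T := T) (o := o) (v := 1) hε0.le (hεr j hj) ?_ le_rfl
        · simpa using h3
        · intro hc
          exact hex g hg' j hj ⟨har.reach hg' h1, by simpa [val, h2] using hc⟩
      · simp only [h1, h2, if_false]
        exact le_price (price_nonpos _ _ _) fun j hj har =>
          price_le_gain ε hj (Or.inr ⟨g, hg', rfl, h2, har.reach hg' h1⟩)
  have hcard : ∑ i ∈ Finset.range T.n, (e i - (T.r i - 1) * d i) = 0 := by
    have h1 : ∀ i, e i - (T.r i - 1) * d i =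
        ((T.large y i + T.small y i : ℕ) : ℝ) - ((T.large o i + T.small o i : ℕ) : ℝ) := by
      intro i
      simp only [he, hd, util_eq]; push_cast; ring
    simp only [h1, Finset.sum_sub_distrib]
    rw [← Nat.cast_sum, ← Nat.cast_sum, sum_card hy, sum_card ho, sub_self]
  have hsum : ε * ∑ i ∈ Finset.range T.n, e i ≤ 0 := by
    have h1 : ∑ i ∈ Finset.range T.n, (π i + T.r i - 1) * d i ≤
        ∑ i ∈ Finset.range T.n, (1 - ε) * e i :=
      Finset.sum_le_sum fun i hi => hagent i (Finset.mem_range.1 hi)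
    have h2 : ∑ i ∈ Finset.range T.n, (π i + T.r i - 1) * d i =
        ∑ i ∈ Finset.range T.n, π i * d i + ∑ i ∈ Finset.range T.n, e i -
          ∑ i ∈ Finset.range T.n, (e i - (T.r i - 1) * d i) := by
      rw [← Finset.sum_add_distrib, ← Finset.sum_sub_distrib]
      exact Finset.sum_congr rfl fun i _ => by ring
    rw [← Finset.mul_sum] at h1
    linarith
  obtain ⟨j, hj, hlt⟩ := hdom.2
  have hej : 0 < e j := by
    have : (T.util o j : ℝ) < T.util y j := by exact_mod_cast hlt
    simp only [he]; linarith
  have : e j ≤ ∑ i ∈ Finset.range T.n, e i :=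
    Finset.single_le_sum (fun i hi => he0 i (Finset.mem_range.1 hi)) (Finset.mem_range.2 hj)
  nlinarith

theorem util_update {f : ℕ} (hf : f < T.m) (o : ℕ → ℕ) (c i : ℕ) :
    T.util (Function.update o f c) i + (if o f = i then T.val i f else 0) =
      T.util o i + (if c = i then T.val i f else 0) := by
  have hmem := Finset.mem_range.2 hf
  simp only [util]
  rw [← Finset.add_sum_erase _ _ hmem,
    ← Finset.add_sum_erase _ (fun g => if o g = i then T.val i g else 0) hmem]
  have : ∀ g ∈ (Finset.range T.m).erase f,
      (if Function.update o f c g = i then T.val i g else 0) =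
        if o g = i then T.val i g else 0 := by
    intro g hg
    rw [Function.update_of_ne (Finset.ne_of_mem_erase hg)]
  rw [Finset.sum_congr rfl this, Function.update_self]
  omega

theorem Valid.update {o : ℕ → ℕ} (ho : T.Valid o) (f : ℕ) {c : ℕ} (hc : c < T.n) :
    T.Valid (Function.update o f c) := by
  intro g hg
  rw [Function.update_apply]
  split
  exacts [hc, ho g hg]

theorem Dom.trans {o₁ o₂ o₃ : ℕ → ℕ} (h₁ : T.Dom o₃ o₂) (h₂ : T.Dom o₂ o₁) : T.Dom o₃ o₁ := by
  refine ⟨fun i hi => (h₂.1 i hi).trans (h₁.1 i hi), ?_⟩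
  obtain ⟨j, hj, hlt⟩ := h₁.2
  exact ⟨j, hj, (h₂.1 j hj).trans_lt hlt⟩

theorem one_le_val (hr : ∀ i < T.n, 2 ≤ T.r i) {i : ℕ} (hi : i < T.n) (g : ℕ) :
    1 ≤ T.val i g := by
  have := hr i hi
  rw [val]; split <;> omega

/-! ### Chains of Pareto-improvements are short -/

/-- The sum over the agents `i` of the number of pairs `(l, s)` with `l, s ≤ m` such that the bundle
of `i` is worth more to her than `l` large and `s` small goods. A Pareto-improvement increases
it. -/
def rank (T : Table) (o : ℕ → ℕ) : ℕ :=
  ∑ i ∈ Finset.range T.n, ((Finset.range (T.m + 1) ×ˢ Finset.range (T.m + 1)).filter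
    fun p => T.r i * p.1 + p.2 < T.util o i).card

theorem rank_le (o : ℕ → ℕ) : T.rank o ≤ T.n * ((T.m + 1) * (T.m + 1)) := by
  have : ∀ i ∈ Finset.range T.n, ((Finset.range (T.m + 1) ×ˢ Finset.range (T.m + 1)).filter
      fun p => T.r i * p.1 + p.2 < T.util o i).card ≤ (T.m + 1) * (T.m + 1) := fun i _ =>
    (Finset.card_filter_le _ _).trans (by simp)
  simpa [rank] using Finset.sum_le_sum this

theorem large_add_small_le (o : ℕ → ℕ) (i : ℕ) : T.large o i + T.small o i ≤ T.m := by
  rw [large_add_small]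
  exact (Finset.sum_le_sum (g := fun _ => 1) fun g _ => by split <;> simp).trans (by simp)

theorem rank_lt_of_dom {o o' : ℕ → ℕ} (h : T.Dom o' o) : T.rank o < T.rank o' := by
  obtain ⟨hle, j, hj, hlt⟩ := h
  refine Finset.sum_lt_sum (fun i hi => Finset.card_le_card fun p hp => ?_)
    ⟨j, Finset.mem_range.2 hj, Finset.card_lt_card ?_⟩
  · simp only [Finset.mem_filter] at hp ⊢
    exact ⟨hp.1, hp.2.trans_le (hle i (Finset.mem_range.1 hi))⟩
  · rw [Finset.ssubset_iff_of_subset fun p hp => by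
      simp only [Finset.mem_filter] at hp ⊢
      exact ⟨hp.1, hp.2.trans hlt⟩]
    have hb := large_add_small_le (T := T) o j
    refine ⟨(T.large o j, T.small o j), ?_, ?_⟩
    · simp only [Finset.mem_filter, Finset.mem_product, Finset.mem_range, ← util_eq]
      exact ⟨⟨by omega, by omega⟩, hlt⟩
    · simp [← util_eq]

/-! ### Marking the goods that can be passed on -/

/-- Agent `o h` holds `h` as a large good and `g` is large for her as well. -/
def Step (T : Table) (o : ℕ → ℕ) (g h : ℕ) : Prop := T.lg (o h) h ≠ 0 ∧ T.lg (o h) g ≠ 0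

/-- Goods with a positive `lev` can be passed on to `j`: those that are not large for `j` are
exchanged for the good `nxt`, which has a smaller positive `lev`. -/
structure Marks (T : Table) (o : ℕ → ℕ) (j : ℕ) (lev nxt : ℕ → ℕ) : Prop where
  base : ∀ h < T.m, T.lg j h ≠ 0 → lev h ≠ 0
  next : ∀ h < T.m, lev h ≠ 0 → T.lg j h = 0 →
    nxt h < T.m ∧ lev (nxt h) ≠ 0 ∧ lev (nxt h) < lev h ∧ T.Step o h (nxt h)

/-- No good can be marked in addition. -/
def Closed (T : Table) (o lev : ℕ → ℕ) : Prop :=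
  ∀ g < T.m, ∀ h < T.m, lev h ≠ 0 → T.Step o g h → lev g ≠ 0

theorem Marks.update {o : ℕ → ℕ} {j : ℕ} {lev nxt : ℕ → ℕ} (M : T.Marks o j lev nxt) {g h : ℕ}
    (hg : g < T.m) (hh : h < T.m) (hlg : lev g = 0) (hlh : lev h ≠ 0) (hs : T.Step o g h) :
    T.Marks o j (Function.update lev g (lev h + 1)) (Function.update nxt g h) := by
  have hne : h ≠ g := by rintro rfl; exact hlh hlg
  refine ⟨fun x hx hjx => ?_, fun x hx hlx hjx => ?_⟩
  · rw [Function.update_apply]; split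
    · omega
    · exact M.base x hx hjx
  · by_cases hxg : x = g
    · subst hxg
      simp only [Function.update_self, Function.update_of_ne hne]
      exact ⟨hh, hlh, by omega, hs⟩
    · rw [Function.update_of_ne hxg] at hlx
      obtain ⟨h1, h2, h3, h4⟩ := M.next x hx hlx hjx
      have hne' : nxt x ≠ g := by intro h; rw [h] at h2; exact h2 hlg
      simp only [Function.update_of_ne hxg, Function.update_of_ne hne']
      exact ⟨h1, h2, h3, h4⟩

theorem Marks.reach {o : ℕ → ℕ} {j : ℕ} {lev nxt : ℕ → ℕ} (M : T.Marks o j lev nxt) {g : ℕ}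
    (hg : g < T.m) (hl : lev g ≠ 0) : T.Reach o j g := by
  induction hk : lev g using Nat.strong_induction_on generalizing g with
  | _ k ih =>
    by_cases hj : T.lg j g = 0
    · obtain ⟨h1, h2, h3, h4⟩ := M.next g hg hl hj
      exact .step hg h1 h4.1 h4.2 (ih _ (hk ▸ h3) h1 h2 rfl)
    · exact .base hg hj

theorem Marks.marked {o : ℕ → ℕ} {j : ℕ} {lev nxt : ℕ → ℕ} (M : T.Marks o j lev nxt)
    (hc : T.Closed o lev) {g : ℕ} (h : T.Reach o j g) : lev g ≠ 0 := by
  induction h with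
  | base hg h => exact M.base _ hg h
  | step hg hh hl hlg _ ih => exact hc _ hg _ hh ih ⟨hl, hlg⟩

/-! ### Passing a good along a chain of marks -/

/-- The allocation `o` arises from `o₀` when the good `g` is passed on along a chain of marks, and
`f` is the good that has currently been released, though `o` still names its last owner. -/
structure Passing (T : Table) (o₀ lev : ℕ → ℕ) (g j : ℕ) (o : ℕ → ℕ) (f : ℕ) : Prop where
  valid : T.Valid o
  lt : f < T.m
  marked : lev f ≠ 0
  -- the owners change from high to low `lev`, so that the rest of the chain is still intact
  same : ∀ h < T.m, lev h < lev f → o h = o₀ h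
  util : ∀ i, T.util o i + (if o₀ g = i then T.val (o₀ g) g else 0) =
    T.util o₀ i + (if o f = i then T.val i f else 0)
  held : f = g ∨ T.lg (o₀ f) f ≠ 0
  owner : o f = o₀ f
  small : ∀ h < T.m, T.lg j h = 0 → (o h = j → o₀ h = j) ∧ (h ≠ g → o₀ h = j → o h = j)

/-- The allocation `o` arises from `o₀` when the good `g` is passed on to `j`. -/
structure Passed (T : Table) (o₀ : ℕ → ℕ) (g j : ℕ) (o : ℕ → ℕ) : Prop where
  valid : T.Valid o
  util : ∀ i, T.util o i + (if o₀ g = i then T.val (o₀ g) g else 0) =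
    T.util o₀ i + (if j = i then T.r j else 0)
  small : ∀ h < T.m, T.lg j h = 0 → (o h = j → o₀ h = j) ∧ (h ≠ g → o₀ h = j → o h = j)

theorem Passing.init {o₀ lev : ℕ → ℕ} {g j : ℕ} (ho : T.Valid o₀) (hg : g < T.m)
    (hl : lev g ≠ 0) : T.Passing o₀ lev g j o₀ g where
  valid := ho
  lt := hg
  marked := hl
  same _ _ _ := rfl
  util i := by by_cases h : o₀ g = i <;> simp [h]
  held := Or.inl rfl
  owner := rfl
  small _ _ _ := ⟨id, fun _ => id⟩

theorem Passing.finish {o₀ lev o : ℕ → ℕ} {g j f : ℕ} (P : T.Passing o₀ lev g j o f) (hj : j < T.n)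
    (hjf : T.lg j f ≠ 0) : T.Passed o₀ g j (Function.update o f j) where
  valid := P.valid.update f hj
  util i := by
    have h1 := util_update P.lt o j i
    have h2 := P.util i
    have h3 : (if j = i then T.val i f else 0) = if j = i then T.r j else 0 := by
      split
      · subst i; simp [val, hjf]
      · rfl
    omega
  small h hh hjh := by
    have : h ≠ f := by rintro rfl; exact hjf hjh
    rw [Function.update_of_ne this]
    exact P.small h hh hjh

theorem Passing.next {o₀ lev nxt o : ℕ → ℕ} {g j f : ℕ} (P : T.Passing o₀ lev g j o f)
    (ho : T.Valid o₀) (M : T.Marks o₀ j lev nxt) (hjf : T.lg j f = 0) :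
    lev (nxt f) < lev f ∧ T.Passing o₀ lev g j (Function.update o f (o (nxt f))) (nxt f) := by
  obtain ⟨h1, h2, h3, h4, h5⟩ := M.next f P.lt P.marked hjf
  have hne : nxt f ≠ f := by intro h; rw [h] at h3; exact lt_irrefl _ h3
  have hown : o (nxt f) = o₀ (nxt f) := P.same _ h1 h3
  refine ⟨h3, P.valid.update f (hown ▸ ho _ h1), h1, h2, ?_, ?_, Or.inr h4, ?_, ?_⟩
  · intro h hh hlt
    have : h ≠ f := by rintro rfl; omega
    rw [Function.update_of_ne this]
    exact P.same h hh (by omega)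
  · intro i
    have e1 := util_update P.lt o (o (nxt f)) i
    have e2 := P.util i
    rw [Function.update_of_ne hne]
    have e3 : (if o (nxt f) = i then T.val i f else 0) =
        if o (nxt f) = i then T.val i (nxt f) else 0 := by
      split
      · next h => rw [hown] at h; subst h; simp [val, h4, h5]
      · rfl
    omega
  · rw [Function.update_of_ne hne, hown]
  · intro h hh hjh
    by_cases hhf : h = f
    · subst hhf
      rw [Function.update_self, hown]
      refine ⟨fun hc => ?_, fun hg hc => ?_⟩
      · rw [hc] at h5; exact absurd hjf h5
      · rcases P.held with hP | hP
        · exact absurd hP hg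
        · rw [hc] at hP; exact absurd hjf hP
    · rw [Function.update_of_ne hhf]
      exact P.small h hh hjh

/-! ### Paying with small goods -/

/-- The number of goods below `k` in the bundle of `j` that are small for her. -/
def smallBelow (T : Table) (o : ℕ → ℕ) (j k : ℕ) : ℕ :=
  ∑ g ∈ Finset.range k, if o g = j ∧ T.lg j g = 0 then 1 else 0

/-- The allocation `o` arises from `o₁` when `j` gives `i` her small goods below `k`, in order,
until she has given `v`; so far `v - c` have been given. -/
structure Paying (T : Table) (o₁ : ℕ → ℕ) (i j v k : ℕ) (o : ℕ → ℕ) (c : ℕ) : Prop where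
  valid : T.Valid o
  same : ∀ h, k ≤ h → o h = o₁ h
  count : c = v - T.smallBelow o₁ j k
  le : c ≤ v
  payee : T.util o₁ i + v ≤ T.util o i + c
  payer : T.util o₁ j + c ≤ T.util o j + v
  rest : ∀ l, l ≠ i → l ≠ j → T.util o l = T.util o₁ l

theorem Paying.init {o₁ : ℕ → ℕ} (ho : T.Valid o₁) (i j v : ℕ) : T.Paying o₁ i j v 0 o₁ v where
  valid := ho
  same _ _ := rfl
  count := by simp [smallBelow]
  le := le_rfl
  payee := le_rfl
  payer := le_rfl
  rest _ _ _ := rfl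

theorem Paying.keep {o₁ o : ℕ → ℕ} {i j v k c : ℕ} (P : T.Paying o₁ i j v k o c)
    (h : c = 0 ∨ ¬ (o k = j ∧ T.lg j k = 0)) : T.Paying o₁ i j v (k + 1) o c where
  valid := P.valid
  same h hh := P.same h (by omega)
  count := by
    have := P.count
    rw [P.same k le_rfl] at h
    rw [smallBelow, Finset.sum_range_succ, ← smallBelow]
    rcases h with h | h
    · omega
    · rwa [if_neg h, add_zero]
  le := P.le
  payee := P.payee
  payer := P.payer
  rest := P.rest

theorem Paying.pay {o₁ o : ℕ → ℕ} {i j v k c : ℕ} (P : T.Paying o₁ i j v k o c)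
    (hr : ∀ i < T.n, 2 ≤ T.r i) (hk : k < T.m) (hi : i < T.n) (hij : i ≠ j) (hc : c ≠ 0)
    (hoj : o k = j) (hjk : T.lg j k = 0) :
    T.Paying o₁ i j v (k + 1) (Function.update o k i) (c - 1) where
  valid := P.valid.update k hi
  same h hh := by rw [Function.update_of_ne (by omega)]; exact P.same h (by omega)
  count := by
    have := P.count
    rw [smallBelow, Finset.sum_range_succ, ← smallBelow, if_pos ⟨P.same k le_rfl ▸ hoj, hjk⟩]
    omega
  le := by have := P.le; omega
  payee := by
    have h1 := util_update hk o i i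
    have h2 := P.payee
    have h3 := one_le_val hr hi k
    rw [if_pos rfl, if_neg (by rw [hoj]; exact hij.symm)] at h1
    omega
  payer := by
    have h1 := util_update hk o i j
    have h2 := P.payer
    have h3 := P.le
    have h4 : T.val j k = 1 := by simp [val, hjk]
    rw [if_pos hoj, if_neg hij, h4] at h1
    omega
  rest l hli hlj := by
    have h1 := util_update hk o i l
    rw [if_neg (by rw [hoj]; exact hlj.symm), if_neg hli.symm] at h1
    rw [← P.rest l hli hlj]
    omega

/-- Passing on `g` to `j` and paying its former owner makes a Pareto-improvement. -/
theorem Passed.dom {o₀ o₁ o : ℕ → ℕ} {g j c : ℕ} (P : T.Passed o₀ g j o₁) (hij : o₀ g ≠ j)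
    (hj : j < T.n) (hv : T.val (o₀ g) g < T.r j) (hs : T.val (o₀ g) g ≤ T.small o₀ j)
    (Q : T.Paying o₁ (o₀ g) j (T.val (o₀ g) g) T.m o c) : T.Dom o o₀ := by
  have hsm : T.smallBelow o₁ j T.m = T.small o₀ j := by
    refine Finset.sum_congr rfl fun h hh => ?_
    congr 1
    refine propext (and_congr_left fun hl => ?_)
    have := P.small h (Finset.mem_range.1 hh) hl
    refine ⟨this.1, fun ho => this.2 ?_ ho⟩
    rintro rfl
    exact hij ho
  have hc : c = 0 := by have := Q.count; rw [hsm] at this; omega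
  have hj' : T.util o₀ j < T.util o j := by
    have h1 := P.util j
    have h2 := Q.payer
    rw [if_neg hij, if_pos rfl] at h1
    omega
  refine ⟨fun l _ => ?_, j, hj, hj'⟩
  by_cases hlj : l = j
  · exact hlj ▸ hj'.le
  · have h1 := P.util l
    rw [if_neg (Ne.symm hlj)] at h1
    by_cases hli : l = o₀ g
    · have h2 := Q.payee
      rw [if_pos hli.symm] at h1
      subst hli
      omega
    · have h2 := Q.rest l hli hlj
      rw [if_neg (Ne.symm hli)] at h1
      omega

/-- Passing on one of the goods of `j` to `j` herself makes a Pareto-improvement as it stands. -/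
theorem Passed.dom_self {o₀ o₁ : ℕ → ℕ} {g : ℕ} (P : T.Passed o₀ g (o₀ g) o₁) (hj : o₀ g < T.n)
    (hv : T.val (o₀ g) g < T.r (o₀ g)) : T.Dom o₁ o₀ := by
  have h : ∀ l, l ≠ o₀ g → T.util o₁ l = T.util o₀ l := fun l hl => by
    have h1 := P.util l
    rw [if_neg hl.symm, if_neg hl.symm] at h1
    omega
  have h' : T.util o₀ (o₀ g) < T.util o₁ (o₀ g) := by
    have h1 := P.util (o₀ g)
    rw [if_pos rfl, if_pos rfl] at h1
    omega
  refine ⟨fun l _ => ?_, _, hj, h'⟩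
  by_cases hl : l = o₀ g
  · exact hl ▸ h'.le
  · exact (h l hl).ge

end Table
end FairDivision

/-! ### Memory layout -/

/- Registers `0`, `1`, `2` hold the length of the input, `n` and `m`. An exchange passes on good
`rGood` to agent `rAgent`; the former owner `rOwner` of the good still has to get `rValue` small
goods. While the good is being passed on, `rOpen` is `1` and `rFree` is the good currently released.
`rCount` counts small goods, `rFlag` is set to `1` when an exchange takes place, and the remaining
registers are loop counters. -/
local notation "rAgent" => 3
local notation "rGood" => 4
local notation "rItem" => 5
local notation "rPartner" => 6
local notation "rRound" => 7
local notation "rCount" => 8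
local notation "rValue" => 9
local notation "rFree" => 10
local notation "rOpen" => 11
local notation "rOwner" => 12
local notation "rFlag" => 13

/- Array `0` holds the input, `aRow` the addresses in it of the rows of the table of large goods,
`aOwner` the allocation, and `aLev` and `aNext` the marks of `Table.Marks`. -/
local notation "aOwner" => 1
local notation "aRow" => 2
local notation "aLev" => 3
local notation "aNext" => 4

namespace RAM

open FairDivision

namespace Cmd

@[simp] theorem exec_skip (s : State) : skip.exec s = s := rfl
@[simp] theorem exec_assign (x : ℕ) (e : Expr) (s : State) :
    (assign x e).exec s = s.setReg x (e.eval s) := rfl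
@[simp] theorem exec_store (A : ℕ) (a e : Expr) (s : State) :
    (store A a e).exec s = s.setCell A (a.eval s) (e.eval s) := rfl
@[simp] theorem exec_write (e : Expr) (s : State) :
    (write e).exec s = { s with out := s.out ++ [e.eval s] } := rfl
@[simp] theorem exec_seq (p q : Cmd) (s : State) : (seq p q).exec s = q.exec (p.exec s) := rfl
@[simp] theorem exec_ite (e : Expr) (p q : Cmd) (s : State) :
    (ite e p q).exec s = if e.eval s = 0 then q.exec s else p.exec s := rfl

end Cmd

/-- The instance in the memory. -/
def State.table (s : State) : Table where
  n := s.reg 1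
  m := s.reg 2
  r i := s.arr 0 (2 + i)
  lg i g := s.arr 0 (s.arr aRow i + g)

/-- The allocation in the memory. -/
abbrev State.owner (s : State) : ℕ → ℕ := s.arr aOwner

attribute [simp] State.owner

/-- The entry for agent `i` and good `g` in the table of large goods. -/
def Expr.largeAt (i g : Expr) : Expr := .cell 0 (.cell aRow i + g)

/-- The ratio of agent `i`. -/
def Expr.ratioAt (i : Expr) : Expr := .cell 0 (.lit 2 + i)

/-- The sum of the two truncated differences, which is nonzero iff the values differ. -/
def Expr.neq (e f : Expr) : Expr := e - f + (f - e)

theorem Expr.eval_neq (s : State) (e f : Expr) :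
    (Expr.neq e f).eval s = 0 ↔ e.eval s = f.eval s := by
  simp only [neq, eval_add, eval_sub]
  omega

@[simp] theorem Expr.eval_largeAt (s : State) (i g : Expr) :
    (Expr.largeAt i g).eval s = s.table.lg (i.eval s) (g.eval s) := rfl

@[simp] theorem Expr.eval_ratioAt (s : State) (i : Expr) :
    (Expr.ratioAt i).eval s = s.table.r (i.eval s) := rfl

@[simp] theorem State.table_n (s : State) : s.table.n = s.reg 1 := rfl
@[simp] theorem State.table_m (s : State) : s.table.m = s.reg 2 := rfl

theorem State.table_congr {s s' : State} (h1 : s'.reg 1 = s.reg 1) (h2 : s'.reg 2 = s.reg 2)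
    (h3 : s'.arr 0 = s.arr 0) (h4 : s'.arr aRow = s.arr aRow) : s'.table = s.table := by
  simp [State.table, h1, h2, h3, h4]

theorem State.table_setReg (s : State) {x : ℕ} (hx : 2 < x) (v : ℕ) :
    (s.setReg x v).table = s.table :=
  State.table_congr (by simp; omega) (by simp; omega) rfl rfl

/-- The program does not change the instance in the memory. -/
def Cmd.keepsTable (c : Cmd) : Bool :=
  !c.writesReg 1 && !c.writesReg 2 && !c.writesArr 0 && !c.writesArr aRow

theorem Cmd.Agree.table {c : Cmd} {s s' : State} (h : c.Agree s s') (hc : c.keepsTable = true) :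
    s'.table = s.table := by
  simp only [keepsTable, Bool.and_eq_true, Bool.not_eq_true'] at hc
  exact State.table_congr (h.reg _ hc.1.1.1) (h.reg _ hc.1.1.2) (h.arr _ hc.1.2) (h.arr _ hc.2)

open Cmd Table

/-! ### Marking -/

/-- Mark the goods that are large for agent `rAgent`. -/
def fillCmd : Cmd := .for_ rItem 2 (.store aLev (.reg rItem) (.largeAt (.reg rAgent) (.reg rItem)))

/-- Mark good `rItem` if it can be exchanged for the marked good `rPartner`. -/
def stepCmd : Cmd :=
  .ite (.cell aLev (.reg rItem)) .skip
    (.ite (.cell aLev (.reg rPartner))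
      (.ite (.largeAt (.cell aOwner (.reg rPartner)) (.reg rPartner))
        (.ite (.largeAt (.cell aOwner (.reg rPartner)) (.reg rItem))
          (.seq (.store aLev (.reg rItem) (.cell aLev (.reg rPartner) + .lit 1))
            (.store aNext (.reg rItem) (.reg rPartner)))
          .skip)
        .skip)
      .skip)

/-- One round of marking. -/
def roundCmd : Cmd := .for_ rItem 2 (.for_ rPartner 2 stepCmd)

/-- Mark the goods that can be passed on to agent `rAgent`. -/
def markCmd : Cmd := .seq fillCmd (.for_ rRound 0 roundCmd)

theorem fill_spec (s : State) :
    ∀ h < s.reg 2, (fillCmd.exec s).arr aLev h = s.table.lg (s.reg rAgent) h := by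
  refine exec_for_inv s
    (fun k s' => ∀ h < k, s'.arr aLev h = s.table.lg (s.reg rAgent) h) (by simp) ?_
  intro k s' hk hx hag ih h hh
  have ht := hag.table rfl
  have hJ : s'.reg rAgent = s.reg rAgent := hag.reg rAgent rfl
  by_cases hhk : h = k
  · subst hhk; simp [hx, ht, hJ]
  · simpa [hx, hhk] using ih h (by omega)

open Classical in
theorem step_exec (s : State) :
    stepCmd.exec s = if s.arr aLev (s.reg rItem) = 0 ∧ s.arr aLev (s.reg rPartner) ≠ 0 ∧
        s.table.Step s.owner (s.reg rItem) (s.reg rPartner) then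
      (s.setCell aLev (s.reg rItem) (s.arr aLev (s.reg rPartner) + 1)).setCell aNext (s.reg rItem)
        (s.reg rPartner) else s := by
  simp only [stepCmd, exec_ite, exec_seq, exec_store, exec_skip, Expr.eval_cell, Expr.eval_reg,
    Expr.eval_largeAt, Expr.eval_add, Expr.eval_lit, Step, State.setCell_reg, State.owner]
  by_cases h1 : s.arr aLev (s.reg rItem) = 0 <;> by_cases h2 : s.arr aLev (s.reg rPartner) = 0 <;>
    by_cases h3 : s.table.lg (s.arr aOwner (s.reg rPartner)) (s.reg rPartner) = 0 <;>
    by_cases h4 : s.table.lg (s.arr aOwner (s.reg rPartner)) (s.reg rItem) = 0 <;>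
    simp [h1, h2, h3, h4]

/-- The state of a round of marking that started with the marks `lev₀` and that has gone through the
pairs of goods before `(k, k')`. -/
structure Round (T : Table) (o : ℕ → ℕ) (j : ℕ) (lev₀ : ℕ → ℕ) (k k' : ℕ) (lev nxt : ℕ → ℕ) :
    Prop where
  marks : T.Marks o j lev nxt
  mono : ∀ x, lev₀ x ≠ 0 → lev x ≠ 0
  done : ∀ g < T.m, ∀ h < T.m, (g < k ∨ g = k ∧ h < k') → lev₀ h ≠ 0 → T.Step o g h → lev g ≠ 0
  closed : T.Closed o lev₀ → lev = lev₀

theorem step_spec {s : State} {j : ℕ} {lev₀ : ℕ → ℕ} (hH : s.reg rItem < s.reg 2)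
    (hH' : s.reg rPartner < s.reg 2)
    (R : Round s.table s.owner j lev₀ (s.reg rItem) (s.reg rPartner) (s.arr aLev) (s.arr aNext)) :
    Round s.table s.owner j lev₀ (s.reg rItem) (s.reg rPartner + 1)
      ((stepCmd.exec s).arr aLev) ((stepCmd.exec s).arr aNext) := by
  rw [step_exec]
  split
  · next h =>
    simp only [State.setCell_arr]
    refine ⟨by simpa using R.marks.update hH hH' h.1 h.2.1 h.2.2, fun x hx => ?_,
      fun g hg g' hg' hp hl hs => ?_, fun hc => ?_⟩
    · have := R.mono x hx
      by_cases hxk : x = s.reg rItem <;> simp [hxk, this]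
    · by_cases hgk : g = s.reg rItem
      · simp [hgk]
      · have := R.done g hg g' hg' (by omega) hl hs
        simpa [hgk] using this
    · exfalso
      have h1 := h.1
      have h2 := h.2.1
      rw [R.closed hc] at h1 h2
      exact hc _ hH _ hH' h2 h.2.2 h1
  · next h =>
    refine ⟨R.marks, R.mono, fun g hg g' hg' hp hl hs => ?_, R.closed⟩
    by_cases hgk : g = s.reg rItem ∧ g' = s.reg rPartner
    · obtain ⟨rfl, rfl⟩ := hgk
      intro h0
      exact h ⟨h0, R.mono _ hl, hs⟩
    · exact R.done g hg g' hg' (by omega) hl hs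

theorem round_spec (s : State) {j : ℕ} (M : s.table.Marks s.owner j (s.arr aLev) (s.arr aNext)) :
    Round s.table s.owner j (s.arr aLev) (s.reg 2) 0
      ((roundCmd.exec s).arr aLev) ((roundCmd.exec s).arr aNext) := by
  refine exec_for_inv s (fun k s' => Round s.table s.owner j (s.arr aLev) k 0
    (s'.arr aLev) (s'.arr aNext)) ?_ ?_
  · exact ⟨M, fun _ => id, fun g _ h _ hp => by omega, fun _ => rfl⟩
  intro k s₁ hk hx hag R
  have ht := hag.table rfl
  have ho : s₁.owner = s.owner := hag.arr _ rfl
  have hm : s₁.reg 2 = s.reg 2 := hag.reg 2 rfl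
  have key : Round s.table s.owner j (s.arr aLev) k (s₁.reg 2)
      (((for_ rPartner 2 stepCmd).exec s₁).arr aLev)
      (((for_ rPartner 2 stepCmd).exec s₁).arr aNext) := by
    refine exec_for_inv s₁ (fun k' s' => Round s.table s.owner j (s.arr aLev) k k'
      (s'.arr aLev) (s'.arr aNext)) R ?_
    intro k' s₂ hk' hx' hag' R'
    have ht' := hag'.table rfl
    have ho' : s₂.owner = s₁.owner := hag'.arr _ rfl
    have hm' : s₂.reg 2 = s₁.reg 2 := hag'.reg 2 rfl
    have hH : s₂.reg rItem = s₁.reg rItem := hag'.reg rItem rfl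
    have := step_spec (s := s₂) (j := j) (lev₀ := s.arr aLev) (by omega) (by omega)
      (by rw [ht', ht, ho', ho, hH, hx, hx']; exact R')
    rw [ht', ht, ho', ho, hH, hx, hx'] at this
    exact this
  rw [hm] at key
  refine ⟨key.marks, key.mono, fun g hg h hh hp => ?_, key.closed⟩
  have : h < s.reg 2 := hh
  exact key.done g hg h hh (by omega)

/-- After the marking, exactly the goods that can be passed on are marked. -/
theorem mark_spec (s : State) (hm : s.reg 2 < s.reg 0) :
    s.table.Marks s.owner (s.reg rAgent) ((markCmd.exec s).arr aLev)
        ((markCmd.exec s).arr aNext) ∧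
      s.table.Closed s.owner ((markCmd.exec s).arr aLev) := by
  have hf := fill_spec s
  set s₁ := fillCmd.exec s with hs₁
  have hag₁ := exec_agree fillCmd s
  rw [← hs₁] at hag₁
  have ht₁ := hag₁.table rfl
  have ho₁ : s₁.owner = s.owner := hag₁.arr _ rfl
  have h0 : s₁.reg 0 = s.reg 0 := hag₁.reg 0 rfl
  -- every round marks a new good, unless there is none left to be marked; there are more rounds
  -- than goods
  have key : s.table.Marks s.owner (s.reg rAgent) ((markCmd.exec s).arr aLev)
        ((markCmd.exec s).arr aNext) ∧ (s.table.Closed s.owner ((markCmd.exec s).arr aLev) ∨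
      s₁.reg 0 ≤
        ((Finset.range (s.reg 2)).filter fun h => (markCmd.exec s).arr aLev h ≠ 0).card) := by
    refine exec_for_inv s₁ (fun k s' =>
      s.table.Marks s.owner (s.reg rAgent) (s'.arr aLev) (s'.arr aNext) ∧
        (s.table.Closed s.owner (s'.arr aLev) ∨
          k ≤ ((Finset.range (s.reg 2)).filter fun h => s'.arr aLev h ≠ 0).card)) ?_ ?_
    · refine ⟨⟨fun h hh hl => ?_, fun h hh hl hj => ?_⟩, Or.inr (Nat.zero_le _)⟩
      · simp only [State.setReg_arr]; rwa [hf h hh]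
      · simp only [State.setReg_arr, hf h hh] at hl; exact absurd hj hl
    intro k s₂ hk hx hag₂ ⟨M, hor⟩
    have ht₂ := hag₂.table rfl
    have ho₂ : s₂.owner = s₁.owner := hag₂.arr _ rfl
    have hm₂ : s₂.reg 2 = s₁.reg 2 := hag₂.reg 2 rfl
    have hm₁ : s₁.reg 2 = s.reg 2 := hag₁.reg 2 rfl
    have R := round_spec s₂ (j := s.reg rAgent) (by rw [ht₂, ht₁, ho₂, ho₁]; exact M)
    rw [ht₂, ht₁, ho₂, ho₁, hm₂, hm₁] at R
    refine ⟨R.marks, ?_⟩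
    change _ ∨ k + 1 ≤
      ((Finset.range (s.reg 2)).filter fun h => (roundCmd.exec s₂).arr aLev h ≠ 0).card
    by_cases hc : s.table.Closed s.owner (s₂.arr aLev)
    · left; simpa [R.closed hc] using hc
    · right
      refine (Nat.succ_le_succ (hor.resolve_left hc)).trans (Finset.card_lt_card ?_)
      simp only [Closed, not_forall] at hc
      obtain ⟨g, hg, h, hh, hl, hs, hlg⟩ := hc
      rw [Finset.ssubset_iff_of_subset fun x hx => by
        simp only [Finset.mem_filter] at hx ⊢
        exact ⟨hx.1, R.mono x hx.2⟩]
      refine ⟨g, ?_, by simp_all⟩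
      simp only [Finset.mem_filter, Finset.mem_range]
      exact ⟨hg, R.done g hg h hh (Or.inl hg) hl hs⟩
  refine ⟨key.1, key.2.resolve_right fun h => ?_⟩
  have := (Finset.card_filter_le (Finset.range (s.reg 2))
    (fun h => (markCmd.exec s).arr aLev h ≠ 0))
  rw [Finset.card_range] at this
  omega

/-! ### Performing an exchange -/

/-- Pass on good `rFree` along one mark, if it is still to be passed on. -/
def passStepCmd : Cmd :=
  .ite (.reg rOpen)
    (.ite (.largeAt (.reg rAgent) (.reg rFree))
      (.seq (.store aOwner (.reg rFree) (.reg rAgent)) (.assign rOpen (.lit 0)))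
      (.seq (.store aOwner (.reg rFree) (.cell aOwner (.cell aNext (.reg rFree))))
        (.assign rFree (.cell aNext (.reg rFree)))))
    .skip

/-- Pass on good `rGood` to agent `rAgent` along the marks. -/
def passCmd : Cmd :=
  .seq (.assign rFree (.reg rGood)) (.seq (.assign rOpen (.lit 1)) (.for_ rRound 0 passStepCmd))

theorem pass_spec (s : State) (hm : s.reg 2 < s.reg 0) (ho : s.table.Valid s.owner)
    (M : s.table.Marks s.owner (s.reg rAgent) (s.arr aLev) (s.arr aNext))
    (hG : s.reg rGood < s.reg 2)
    (hJ : s.reg rAgent < s.reg 1) (hl : s.arr aLev (s.reg rGood) ≠ 0) :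
    s.table.Passed s.owner (s.reg rGood) (s.reg rAgent) (passCmd.exec s).owner := by
  set s₁ := (s.setReg rFree (s.reg rGood)).setReg rOpen 1 with hs₁
  have ht₁ : s₁.table = s.table := by
    rw [hs₁, State.table_setReg _ (by norm_num), State.table_setReg _ (by norm_num)]
  have hrun : passCmd.exec s = (for_ rRound 0 passStepCmd).exec s₁ := by
    simp [passCmd, hs₁]
  rw [hrun]
  -- the released goods have decreasing marks, so that less than `m` steps are needed
  have key : ((for_ rRound 0 passStepCmd).exec s₁).reg rOpen = 0 ∧
        s.table.Passed s.owner (s.reg rGood) (s.reg rAgent)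
          ((for_ rRound 0 passStepCmd).exec s₁).owner ∨
      (((for_ rRound 0 passStepCmd).exec s₁).reg rOpen ≠ 0 ∧
        s.table.Passing s.owner (s.arr aLev) (s.reg rGood) (s.reg rAgent)
          ((for_ rRound 0 passStepCmd).exec s₁).owner
          (((for_ rRound 0 passStepCmd).exec s₁).reg rFree) ∧
        ((Finset.range (s.reg 2)).filter fun h => s.arr aLev h <
          s.arr aLev (((for_ rRound 0 passStepCmd).exec s₁).reg rFree)).card + s₁.reg 0 <
          s.reg 2) := by
    refine exec_for_inv s₁ (fun k s' => s'.reg rOpen = 0 ∧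
        s.table.Passed s.owner (s.reg rGood) (s.reg rAgent) s'.owner ∨
      (s'.reg rOpen ≠ 0 ∧
        s.table.Passing s.owner (s.arr aLev) (s.reg rGood) (s.reg rAgent) s'.owner (s'.reg rFree) ∧
        ((Finset.range (s.reg 2)).filter fun h => s.arr aLev h <
          s.arr aLev (s'.reg rFree)).card + k < s.reg 2)) ?_ ?_
    · right
      refine ⟨by simp [hs₁], by simpa [hs₁] using Passing.init ho hG hl, ?_⟩
      rw [add_zero]
      refine (Finset.card_lt_card (Finset.filter_ssubset.2 ⟨s.reg rGood, ?_, ?_⟩)).trans_eq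
        (Finset.card_range _)
      · simpa using hG
      · simp [hs₁]
    intro k s₂ hk hx hag hor
    have ht₂ : s₂.table = s.table := (hag.table rfl).trans ht₁
    have hJ₂ : s₂.reg rAgent = s.reg rAgent := by rw [hag.reg rAgent rfl]; simp [hs₁]
    have hN₂ : s₂.arr aNext = s.arr aNext := by rw [hag.arr aNext rfl]; simp [hs₁]
    rcases hor with ⟨hD, hP⟩ | ⟨hD, hP, hcard⟩
    · left; simpa [passStepCmd, hD] using hP
    · by_cases hjf : s.table.lg (s.reg rAgent) (s₂.reg rFree) = 0
      · right
        obtain ⟨hlt, hP'⟩ := hP.next ho M hjf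
        refine ⟨by simp [passStepCmd, hD, ht₂, hJ₂, hjf],
          by simpa [passStepCmd, hD, ht₂, hJ₂, hjf, hN₂] using hP', ?_⟩
        have : ((Finset.range (s.reg 2)).filter fun h => s.arr aLev h <
            s.arr aLev (s.arr aNext (s₂.reg rFree))).card <
            ((Finset.range (s.reg 2)).filter fun h => s.arr aLev h <
            s.arr aLev (s₂.reg rFree)).card := by
          refine Finset.card_lt_card ?_
          rw [Finset.ssubset_iff_of_subset fun x hx => by
            simp only [Finset.mem_filter] at hx ⊢
            exact ⟨hx.1, hx.2.trans hlt⟩]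
          have := hP'.lt
          exact ⟨_, by simp only [Finset.mem_filter, Finset.mem_range]; exact ⟨this, hlt⟩, by simp⟩
        simp [passStepCmd, hD, ht₂, hJ₂, hjf, hN₂]
        omega
      · left
        have := hP.finish hJ hjf
        refine ⟨by simp [passStepCmd, hD, ht₂, hJ₂, hjf],
          by simpa [passStepCmd, hD, ht₂, hJ₂, hjf] using this⟩
  rcases key with ⟨_, h⟩ | ⟨_, _, h⟩
  · exact h
  · have : s₁.reg 0 = s.reg 0 := by simp [hs₁]
    omega

/-- Give good `rItem` to agent `rOwner` if it is a small good of agent `rAgent` and still needed. -/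
def payStepCmd : Cmd :=
  .ite (.reg rValue)
    (.ite (.neq (.cell aOwner (.reg rItem)) (.reg rAgent)) .skip
      (.ite (.largeAt (.reg rAgent) (.reg rItem)) .skip
        (.seq (.store aOwner (.reg rItem) (.reg rOwner))
          (.assign rValue (.reg rValue - .lit 1)))))
    .skip

/-- Give `rValue` small goods of agent `rAgent` to agent `rOwner`. -/
def payCmd : Cmd := .for_ rItem 2 payStepCmd

theorem payStep_exec (s : State) :
    payStepCmd.exec s = if s.reg rValue = 0 ∨
        ¬ (s.owner (s.reg rItem) = s.reg rAgent ∧ s.table.lg (s.reg rAgent) (s.reg rItem) = 0)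
      then s
      else (s.setCell aOwner (s.reg rItem) (s.reg rOwner)).setReg rValue (s.reg rValue - 1) := by
  simp only [payStepCmd, exec_ite, exec_seq, exec_store, exec_skip, exec_assign, Expr.eval_cell,
    Expr.eval_reg, Expr.eval_largeAt, Expr.eval_sub, Expr.eval_lit, State.setCell_reg,
    Expr.eval_neq]
  split_ifs <;> simp_all

theorem pay_spec (s : State) (hr : ∀ i < s.reg 1, 2 ≤ s.table.r i) (ho : s.table.Valid s.owner)
    (hI : s.reg rOwner < s.reg 1) (hne : s.reg rOwner ≠ s.reg rAgent) :
    ∃ c, s.table.Paying s.owner (s.reg rOwner) (s.reg rAgent) (s.reg rValue) (s.reg 2)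
      (payCmd.exec s).owner c := by
  refine ⟨(payCmd.exec s).reg rValue, exec_for_inv s (fun k s' => s.table.Paying s.owner
    (s.reg rOwner) (s.reg rAgent) (s.reg rValue) k s'.owner (s'.reg rValue)) ?_ ?_⟩
  · simpa using Paying.init ho _ _ _
  intro k s' hk hx hag P
  have ht : s'.table = s.table := hag.table rfl
  have hJ : s'.reg rAgent = s.reg rAgent := hag.reg rAgent rfl
  have hI' : s'.reg rOwner = s.reg rOwner := hag.reg rOwner rfl
  rw [payStep_exec, hJ, ht, hx, hI']
  split
  · next h => simpa using P.keep h
  · next h =>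
    push Not at h
    simpa using P.pay hr hk hI hne h.1 h.2.1 h.2.2

/-- An agent who pays herself keeps what she has. -/
theorem pay_self (s : State) (h : s.reg rOwner = s.reg rAgent) :
    (payCmd.exec s).owner = s.owner := by
  refine exec_for_inv s (fun _ s' => s'.owner = s.owner) rfl ?_
  intro k s' hk hx hag ih
  have hJ : s'.reg rAgent = s.reg rAgent := hag.reg rAgent rfl
  have hI' : s'.reg rOwner = s.reg rOwner := hag.reg rOwner rfl
  rw [payStep_exec]
  split
  · simpa using ih
  · next hc =>
    push Not at hc
    have : s'.arr aOwner (s'.reg rItem) = s.reg rAgent := hc.2.1.trans hJ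
    simp [hI', h, ← this, ih]

/-- Count the small goods of agent `rAgent`. -/
def countCmd : Cmd :=
  .seq (.assign rCount (.lit 0))
    (.for_ rItem 2
      (.ite (.neq (.cell aOwner (.reg rItem)) (.reg rAgent)) .skip
        (.ite (.largeAt (.reg rAgent) (.reg rItem)) .skip
          (.assign rCount (.reg rCount + .lit 1)))))

theorem count_spec (s : State) :
    (countCmd.exec s).reg rCount = s.table.small s.owner (s.reg rAgent) := by
  refine exec_for_inv (s.setReg rCount 0)
    (fun k s' => s'.reg rCount = s.table.smallBelow s.owner (s.reg rAgent) k) ?_ ?_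
  · simp [smallBelow]
  intro k s' hk hx hag ih
  have ht : s'.table = s.table := (hag.table rfl).trans (State.table_setReg _ (by norm_num) _)
  have hJ : s'.reg rAgent = s.reg rAgent := hag.reg rAgent rfl
  have ho : s'.arr aOwner = s.arr aOwner := hag.arr _ rfl
  rw [smallBelow, Finset.sum_range_succ, ← smallBelow, ← ih]
  simp only [exec_ite, exec_skip, exec_assign, Expr.eval_cell,
    Expr.eval_reg, Expr.eval_largeAt, Expr.eval_add, Expr.eval_lit, Expr.eval_neq, hx, ht, hJ,
    ho]
  split_ifs <;> simp_all

/-- Put the owner of good `rGood` into `rOwner` and its value for her into `rValue`. -/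
def valueCmd : Cmd :=
  .seq (.assign rOwner (.cell aOwner (.reg rGood)))
    (.ite (.largeAt (.reg rOwner) (.reg rGood)) (.assign rValue (.ratioAt (.reg rOwner)))
      (.assign rValue (.lit 1)))

theorem value_spec (s : State) :
    (valueCmd.exec s).reg rOwner = s.owner (s.reg rGood) ∧
      (valueCmd.exec s).reg rValue = s.table.val (s.owner (s.reg rGood)) (s.reg rGood) := by
  simp only [valueCmd, exec_seq, exec_assign, exec_ite, Expr.eval_largeAt, Expr.eval_ratioAt,
    Expr.eval_cell, Expr.eval_reg, State.table_setReg _ (show 2 < rOwner by norm_num), val]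
  split_ifs <;> simp_all

/-- Perform the exchange for good `rGood` and agent `rAgent` and set the flag. -/
def exchangeCmd : Cmd := .seq passCmd (.seq payCmd (.assign rFlag (.lit 1)))

/-- Perform the exchange for good `rGood` and agent `rAgent` if it is profitable. -/
def tryCmd : Cmd :=
  .seq markCmd (.seq countCmd (.seq valueCmd
    (.ite (.cell aLev (.reg rGood))
      (.ite (.ratioAt (.reg rAgent) - .reg rValue)
        (.ite (.reg rValue - .reg rCount) .skip exchangeCmd) .skip) .skip)))

/-- Either the allocation has not changed, and then `Q` holds, or the flag has been set and the new
allocation Pareto-dominates the old one. -/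
def Outcome (s s' : State) (Q : Prop) : Prop :=
  (s'.owner = s.owner ∧ s'.reg rFlag = s.reg rFlag ∧ Q) ∨
    (s'.reg rFlag = 1 ∧ s.table.Valid s'.owner ∧ s.table.Dom s'.owner s.owner)

theorem exchange_spec (s : State) (hm : s.reg 2 < s.reg 0)
    (hr : ∀ i < s.reg 1, 2 ≤ s.table.r i) (ho : s.table.Valid s.owner)
    (M : s.table.Marks s.owner (s.reg rAgent) (s.arr aLev) (s.arr aNext))
    (hG : s.reg rGood < s.reg 2)
    (hJ : s.reg rAgent < s.reg 1) (hI : s.reg rOwner = s.owner (s.reg rGood))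
    (hV : s.reg rValue = s.table.val (s.owner (s.reg rGood)) (s.reg rGood))
    (hl : s.arr aLev (s.reg rGood) ≠ 0)
    (hv : s.table.val (s.owner (s.reg rGood)) (s.reg rGood) < s.table.r (s.reg rAgent))
    (hs : s.table.val (s.owner (s.reg rGood)) (s.reg rGood) ≤
      s.table.small s.owner (s.reg rAgent)) :
    (exchangeCmd.exec s).reg rFlag = 1 ∧ s.table.Valid (exchangeCmd.exec s).owner ∧
      s.table.Dom (exchangeCmd.exec s).owner s.owner := by
  have P := pass_spec s hm ho M hG hJ hl
  set s₁ := passCmd.exec s with hs₁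
  have hag := exec_agree passCmd s
  rw [← hs₁] at hag
  have ht : s₁.table = s.table := hag.table rfl
  have hn₁ : s₁.reg 1 = s.reg 1 := hag.reg 1 rfl
  have hm₁ : s₁.reg 2 = s.reg 2 := hag.reg 2 rfl
  have hI₁ : s₁.reg rOwner = s.reg rOwner := hag.reg rOwner rfl
  have hJ₁ : s₁.reg rAgent = s.reg rAgent := hag.reg rAgent rfl
  have hV₁ : s₁.reg rValue = s.reg rValue := hag.reg rValue rfl
  have hown : (exchangeCmd.exec s).owner = (payCmd.exec s₁).owner := by
    simp [exchangeCmd, hs₁]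
  refine ⟨by simp [exchangeCmd], ?_⟩
  rw [hown]
  have hval := P.valid
  by_cases hij : s.owner (s.reg rGood) = s.reg rAgent
  · rw [pay_self s₁ (by rw [hI₁, hJ₁, hI, hij])]
    rw [← hij] at P hJ hv
    exact ⟨hval, P.dom_self hJ hv⟩
  · obtain ⟨c, Q⟩ := pay_spec s₁ (by rw [hn₁, ht]; exact hr) (by rw [ht]; exact hval)
      (by rw [hI₁, hn₁, hI]; exact ho _ hG) (by rw [hI₁, hJ₁, hI]; exact hij)
    rw [ht, hI₁, hJ₁, hV₁, hm₁, hI, hV] at Q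
    exact ⟨Q.valid, P.dom hij hJ hv hs Q⟩

theorem try_spec (s : State) (hm : s.reg 2 < s.reg 0)
    (hr : ∀ i < s.reg 1, 2 ≤ s.table.r i) (ho : s.table.Valid s.owner)
    (hG : s.reg rGood < s.reg 2) (hJ : s.reg rAgent < s.reg 1) :
    Outcome s (tryCmd.exec s) (¬ s.table.Exchange s.owner (s.reg rGood) (s.reg rAgent)) := by
  classical
  obtain ⟨M, hcl⟩ := mark_spec s hm
  have hreach : s.table.Reach s.owner (s.reg rAgent) (s.reg rGood) ↔
      (markCmd.exec s).arr aLev (s.reg rGood) ≠ 0 := ⟨M.marked hcl, M.reach hG⟩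
  set s₁ := markCmd.exec s with hs₁
  have hag₁ := exec_agree markCmd s
  rw [← hs₁] at hag₁
  have ht₁ : s₁.table = s.table := hag₁.table rfl
  have ho₁ : s₁.owner = s.owner := hag₁.arr _ rfl
  have hJ₁ : s₁.reg rAgent = s.reg rAgent := hag₁.reg rAgent rfl
  have hC := count_spec s₁
  set s₂ := countCmd.exec s₁ with hs₂
  have hag₂ := exec_agree countCmd s₁
  rw [← hs₂] at hag₂
  have ht₂ : s₂.table = s₁.table := hag₂.table rfl
  have ho₂ : s₂.owner = s₁.owner := hag₂.arr _ rfl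
  obtain ⟨hI, hV⟩ := value_spec s₂
  set s₃ := valueCmd.exec s₂ with hs₃
  have hag₃ := exec_agree valueCmd s₂
  rw [← hs₃] at hag₃
  have reg₃ : ∀ z, markCmd.writesReg z = false → countCmd.writesReg z = false →
      valueCmd.writesReg z = false → s₃.reg z = s.reg z := fun z h1 h2 h3 => by
    rw [hag₃.reg z h3, hag₂.reg z h2, hag₁.reg z h1]
  have ht₃ : s₃.table = s.table := ((hag₃.table rfl).trans ht₂).trans ht₁
  have ho₃ : s₃.owner = s.owner := ((hag₃.arr _ rfl).trans ho₂).trans ho₁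
  have hlev : s₃.arr aLev = s₁.arr aLev := (hag₃.arr _ rfl).trans (hag₂.arr _ rfl)
  have hnext : s₃.arr aNext = s₁.arr aNext := (hag₃.arr _ rfl).trans (hag₂.arr _ rfl)
  have hJ₃ : s₃.reg rAgent = s.reg rAgent := reg₃ _ rfl rfl rfl
  have hG₃ : s₃.reg rGood = s.reg rGood := reg₃ _ rfl rfl rfl
  have hG₂ : s₂.reg rGood = s.reg rGood := by rw [hag₂.reg _ rfl, hag₁.reg _ rfl]
  have hF₃ : s₃.reg rFlag = s.reg rFlag := reg₃ _ rfl rfl rfl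
  have hC₃ : s₃.reg rCount = s.table.small s.owner (s.reg rAgent) := by
    rw [hag₃.reg _ rfl, hC, ht₁, ho₁, hJ₁]
  rw [ho₂, ho₁, hG₂] at hI hV
  rw [ht₂, ht₁] at hV
  -- the three tests of `tryCmd` are the three conditions of `Exchange`
  have hexec : tryCmd.exec s =
      if s.table.Exchange s.owner (s.reg rGood) (s.reg rAgent) then exchangeCmd.exec s₃
      else s₃ := by
    have : tryCmd.exec s = if s₃.arr aLev (s₃.reg rGood) = 0 then s₃ else
        if s₃.table.r (s₃.reg rAgent) - s₃.reg rValue = 0 then s₃ else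
        if s₃.reg rValue - s₃.reg rCount = 0 then exchangeCmd.exec s₃ else s₃ := rfl
    rw [this, hlev, ht₃, hG₃, hJ₃, hC₃, hV]
    simp only [Exchange, hreach]
    split_ifs <;> first | rfl | (exfalso; omega)
  rw [hexec]
  split
  · next h =>
    right
    have := exchange_spec s₃ (by rw [reg₃ 2 rfl rfl rfl, reg₃ 0 rfl rfl rfl]; exact hm)
      (by rw [reg₃ 1 rfl rfl rfl, ht₃]; exact hr) (by rw [ht₃, ho₃]; exact ho)
      (by rw [ht₃, ho₃, hJ₃, hlev, hnext]; exact M)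
      (by rw [hG₃, reg₃ 2 rfl rfl rfl]; exact hG) (by rw [hJ₃, reg₃ 1 rfl rfl rfl]; exact hJ)
      (by rw [ho₃, hG₃]; exact hI) (by rw [ht₃, ho₃, hG₃]; exact hV)
      (by rw [hlev, hG₃]; exact hreach.1 h.1) (by rw [ht₃, ho₃, hG₃, hJ₃]; exact h.2.1)
      (by rw [ht₃, ho₃, hG₃, hJ₃]; exact h.2.2)
    rw [ht₃, ho₃] at this
    exact this
  · next h => exact Or.inl ⟨ho₃, hF₃, h⟩

/-! ### Improving an allocation -/

/-- Go through all goods and agents once and perform the profitable exchanges. -/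
def improveCmd : Cmd := .for_ rGood 2 (.for_ rAgent 1 tryCmd)

theorem Outcome.valid {s s' : State} {Q : Prop} (h : Outcome s s' Q)
    (ho : s.table.Valid s.owner) : s.table.Valid s'.owner := by
  rcases h with h | h
  · rw [h.1]; exact ho
  · exact h.2.1

theorem Outcome.trans {s s₁ s₂ : State} {Q₁ Q₂ : Prop} (h₁ : Outcome s s₁ Q₁)
    (h₂ : Outcome s₁ s₂ Q₂) (ht : s₁.table = s.table) :
    Outcome s s₂ (Q₁ ∧ s₁.owner = s.owner ∧ Q₂) := by
  rcases h₂ with h₂ | h₂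
  · rcases h₁ with h₁ | h₁
    · exact Or.inl ⟨h₂.1.trans h₁.1, h₂.2.1.trans h₁.2.1, h₁.2.2, h₁.1, h₂.2.2⟩
    · right; rw [h₂.1, h₂.2.1]; exact h₁
  · right
    rw [ht] at h₂
    refine ⟨h₂.1, h₂.2.1, ?_⟩
    rcases h₁ with h₁ | h₁
    · rw [← h₁.1]; exact h₂.2.2
    · exact h₂.2.2.trans h₁.2.2

theorem Outcome.imp {s s' : State} {Q Q' : Prop} (h : Outcome s s' Q) (hQ : Q → Q') :
    Outcome s s' Q' := h.imp_left fun h => ⟨h.1, h.2.1, hQ h.2.2⟩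

theorem improve_spec (s : State) (hm : s.reg 2 < s.reg 0)
    (hr : ∀ i < s.reg 1, 2 ≤ s.table.r i) (ho : s.table.Valid s.owner) :
    Outcome s (improveCmd.exec s) (s.table.Optimal s.owner) := by
  have key : Outcome s (improveCmd.exec s)
      (∀ g < s.reg 2, ∀ j < s.reg 1, ¬ s.table.Exchange s.owner g j) := by
    refine exec_for_inv s (fun k s' => Outcome s s'
      (∀ g < k, ∀ j < s.reg 1, ¬ s.table.Exchange s.owner g j)) ?_ ?_
    · exact Or.inl ⟨rfl, rfl, fun g hg => by omega⟩
    intro k s₁ hk hx hag h₁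
    have ht : s₁.table = s.table := hag.table rfl
    have reg₁ : ∀ z ≤ 2, s₁.reg z = s.reg z := fun z hz => hag.reg z (writesReg_of_ok rfl hz)
    have key' : Outcome s ((for_ rAgent 1 tryCmd).exec s₁) ((∀ g < k, ∀ j < s.reg 1,
        ¬ s.table.Exchange s.owner g j) ∧ ∀ j < s₁.reg 1, ¬ s.table.Exchange s.owner k j) := by
      refine exec_for_inv s₁ (fun k' s' => Outcome s s' ((∀ g < k, ∀ j < s.reg 1,
        ¬ s.table.Exchange s.owner g j) ∧ ∀ j < k', ¬ s.table.Exchange s.owner k j)) ?_ ?_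
      · exact h₁.imp fun h => ⟨h, fun j hj => by omega⟩
      intro k' s₂ hk' hx' hag' h₂
      have ht₂ : s₂.table = s.table := (hag'.table rfl).trans ht
      have reg₂ : ∀ z ≤ 2, s₂.reg z = s.reg z := fun z hz =>
        (hag'.reg z (writesReg_of_ok rfl hz)).trans (reg₁ z hz)
      have hG : s₂.reg rGood = k := (hag'.reg _ rfl).trans hx
      have h₃ := try_spec s₂ (by rw [reg₂ 2 le_rfl, reg₂ 0 (by omega)]; exact hm)
        (by rw [reg₂ 1 (by omega), ht₂]; exact hr) (by rw [ht₂]; exact h₂.valid ho)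
        (by rw [hG, reg₂ 2 le_rfl]; exact hk)
        (by rw [hx', reg₂ 1 (by omega)]; rwa [reg₁ 1 (by omega)] at hk')
      have h₄ := (h₂.trans h₃ ht₂).imp (Q' := (∀ g < k, ∀ j < s.reg 1,
          ¬ s.table.Exchange s.owner g j) ∧ ∀ j < k' + 1, ¬ s.table.Exchange s.owner k j) (by
        rintro ⟨⟨q1, q2⟩, q3, q4⟩
        rw [ht₂, q3, hG, hx'] at q4
        refine ⟨q1, fun j hj => ?_⟩
        rcases Nat.lt_succ_iff_lt_or_eq.1 hj with h | rfl
        exacts [q2 j h, q4])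
      simpa [Outcome] using h₄
    have h₄ := key'.imp (Q' := ∀ g < k + 1, ∀ j < s.reg 1, ¬ s.table.Exchange s.owner g j) (by
      rintro ⟨q1, q2⟩ g hg
      rw [reg₁ 1 (by omega)] at q2
      rcases Nat.lt_succ_iff_lt_or_eq.1 hg with h | rfl
      exacts [q1 g h, q2])
    simpa [Outcome] using h₄
  exact key.imp fun h => optimal_of_no_exchange ho hr h

/-- Go through all goods and agents as many times as the cube of the input length says. -/
def optimizeCmd : Cmd := .for_ 14 0 (.for_ 15 0 (.for_ 16 0 improveCmd))

/-- If the body of a loop raises an index of the invariant by `c`, then the loop raises it by `c`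
times its number of rounds. -/
theorem exec_for_add {x y : ℕ} {p : Cmd} (s : State) {P : ℕ → State → Prop} {k c : ℕ}
    (hset : ∀ k s v, P k s → P k (s.setReg x v)) (h0 : P k s)
    (hstep : ∀ k s', Agree (for_ x y p) s s' → P k s' → P (k + c) (p.exec s')) :
    P (k + s.reg y * c) ((for_ x y p).exec s) := by
  refine exec_for_inv s (fun i s' => P (k + i * c) s') ?_ ?_
  · simpa using hset _ _ 0 h0
  · intro i s' _ _ hag h
    have := hset _ _ (i + 1) (hstep _ _ hag h)
    rwa [show k + i * c + c = k + (i + 1) * c by ring] at this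

theorem optimize_spec (s : State) (hs : s.reg 1 + s.reg 2 + 2 ≤ s.reg 0)
    (hr : ∀ i < s.reg 1, 2 ≤ s.table.r i) (ho : s.table.Valid s.owner) :
    s.table.Valid (optimizeCmd.exec s).owner ∧ s.table.Optimal (optimizeCmd.exec s).owner ∧
      ((optimizeCmd.exec s).owner = s.owner ∨
        s.table.Dom (optimizeCmd.exec s).owner s.owner) := by
  -- a pass over an allocation that is not optimal increases its rank
  let P : ℕ → State → Prop := fun k s' => s'.reg 0 = s.reg 0 ∧ s'.reg 1 = s.reg 1 ∧
    s'.reg 2 = s.reg 2 ∧ s'.table = s.table ∧ s.table.Valid s'.owner ∧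
    (s'.owner = s.owner ∨ s.table.Dom s'.owner s.owner) ∧
    (s.table.Optimal s'.owner ∨ k ≤ s.table.rank s'.owner)
  have hset : ∀ x, 2 < x → ∀ k s' v, P k s' → P k (s'.setReg x v) := by
    intro x hx k s' v h
    obtain ⟨h0, h1, h2, h3, h4⟩ := h
    refine ⟨?_, ?_, ?_, ?_, h4⟩
    · rwa [State.setReg_reg, if_neg (by omega)]
    · rwa [State.setReg_reg, if_neg (by omega)]
    · rwa [State.setReg_reg, if_neg (by omega)]
    · rwa [State.table_setReg _ hx]
  have himp : ∀ k s', P k s' → P (k + 1) (improveCmd.exec s') := by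
    intro k s' ⟨h0, h1, h2, ht, hv, hd, hk⟩
    have hspec := improve_spec s' (by omega) (by rw [h1, ht]; exact hr) (by rw [ht]; exact hv)
    have hag := exec_agree improveCmd s'
    refine ⟨(hag.reg 0 rfl).trans h0, (hag.reg 1 rfl).trans h1, (hag.reg 2 rfl).trans h2,
      (hag.table rfl).trans ht, ?_⟩
    rcases hspec with ⟨e1, _, e2⟩ | ⟨_, e1, e2⟩
    · rw [e1]
      rw [ht] at e2
      exact ⟨hv, hd, Or.inl e2⟩
    · rw [ht] at e1 e2
      refine ⟨e1, Or.inr ?_, ?_⟩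
      · rcases hd with hd | hd
        · rw [← hd]; exact e2
        · exact e2.trans hd
      · rcases hk with hk | hk
        · exact absurd e2 (hk _ e1)
        · exact Or.inr (Nat.succ_le_of_lt (hk.trans_lt (rank_lt_of_dom e2)))
  have h0 : P 0 s := ⟨rfl, rfl, rfl, rfl, ho, Or.inl rfl, Or.inr (Nat.zero_le _)⟩
  have h1 : ∀ k s', P k s' → P (k + s.reg 0 * 1) ((for_ 16 0 improveCmd).exec s') :=
    fun k s' h => by
      rw [← h.1]
      exact exec_for_add s' (hset 16 (by norm_num)) h fun k s' _ h => himp k s' h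
  have h2 : ∀ k s', P k s' →
      P (k + s.reg 0 * (s.reg 0 * 1)) ((for_ 15 0 (.for_ 16 0 improveCmd)).exec s') :=
    fun k s' h => by
      conv => enter [1, 2, 1]; rw [← h.1]
      exact exec_for_add s' (hset 15 (by norm_num)) h fun k s' _ h => h1 k s' h
  have h3 : P (0 + s.reg 0 * (s.reg 0 * (s.reg 0 * 1))) (optimizeCmd.exec s) :=
    exec_for_add s (hset 14 (by norm_num)) h0 fun k s' _ h => h2 k s' h
  obtain ⟨_, _, _, _, hv, hd, hk⟩ := h3
  refine ⟨hv, hk.resolve_right fun hk => ?_, hd⟩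
  have hle := rank_le (T := s.table) (optimizeCmd.exec s).owner
  simp only [State.table_n, State.table_m] at hle
  rw [zero_add, mul_one] at hk
  have h4 : (s.reg 2 + 1) * (s.reg 2 + 1) ≤ s.reg 0 * s.reg 0 :=
    Nat.mul_le_mul (by omega) (by omega)
  have h5 := Nat.mul_le_mul (show s.reg 1 ≤ s.reg 0 - 1 by omega) h4
  have h6 : (s.reg 0 - 1) * (s.reg 0 * s.reg 0) < s.reg 0 * (s.reg 0 * s.reg 0) :=
    Nat.mul_lt_mul_of_pos_right (by omega) (Nat.mul_pos (by omega) (by omega))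
  omega

/-! ### Input and output -/

/-- Compute the addresses of the rows of the table and copy the allocation. -/
def loadCmd : Cmd :=
  .seq (.store aRow (.lit 0) (.lit 2 + .reg 1))
    (.seq (.for_ rAgent 1 (.store aRow (.reg rAgent + .lit 1) (.cell aRow (.reg rAgent) + .reg 2)))
      (.for_ rGood 2 (.store aOwner (.reg rGood) (.cell 0 (.cell aRow (.reg 1) + .reg rGood)))))

theorem load_spec (s : State) :
    (∀ i ≤ s.reg 1, (loadCmd.exec s).arr aRow i = 2 + s.reg 1 + i * s.reg 2) ∧
      ∀ g < s.reg 2,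
        (loadCmd.exec s).owner g = s.arr 0 (2 + s.reg 1 + s.reg 1 * s.reg 2 + g) := by
  set s₁ := s.setCell aRow 0 (2 + s.reg 1) with hs₁
  set p₂ : Cmd := .for_ rAgent 1 (.store aRow (.reg rAgent + .lit 1)
    (.cell aRow (.reg rAgent) + .reg 2)) with hp₂
  set p₃ : Cmd := .for_ rGood 2 (.store aOwner (.reg rGood)
    (.cell 0 (.cell aRow (.reg 1) + .reg rGood))) with hp₃
  have hexec : loadCmd.exec s = p₃.exec (p₂.exec s₁) := rfl
  have h2 : ∀ i ≤ s₁.reg 1, (p₂.exec s₁).arr aRow i = 2 + s.reg 1 + i * s.reg 2 := by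
    refine exec_for_inv s₁ (fun k s' => ∀ i ≤ k, s'.arr aRow i = 2 + s.reg 1 + i * s.reg 2) ?_ ?_
    · intro i hi
      obtain rfl : i = 0 := by omega
      simp [hs₁]
    intro k s' hk hx hag ih i hi
    have hm : s'.reg 2 = s.reg 2 := hag.reg 2 rfl
    by_cases hik : i = k + 1
    · subst hik
      simp [hx, hm, ih k le_rfl]
      ring
    · simpa [hx, hik] using ih i (by omega)
  have hag₂ := exec_agree p₂ s₁
  set s₂ := p₂.exec s₁ with hs₂
  have hn₂ : s₂.reg 1 = s.reg 1 := hag₂.reg 1 rfl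
  have hm₂ : s₂.reg 2 = s.reg 2 := hag₂.reg 2 rfl
  have ha₂ : s₂.arr 0 = s.arr 0 := by rw [hag₂.arr 0 rfl]; simp [hs₁]
  have hag₃ := exec_agree p₃ s₂
  rw [hexec]
  refine ⟨fun i hi => by rw [hag₃.arr aRow rfl]; exact h2 i hi, ?_⟩
  rw [← hm₂]
  refine exec_for_inv s₂ (fun k s' => ∀ g < k,
    s'.owner g = s.arr 0 (2 + s.reg 1 + s.reg 1 * s₂.reg 2 + g)) (fun g hg => by omega) ?_
  intro k s' hk hx hag ih g hg
  have hn : s'.reg 1 = s.reg 1 := (hag.reg 1 rfl).trans hn₂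
  have ha : s'.arr 0 = s.arr 0 := (hag.arr 0 rfl).trans ha₂
  have hrow : s'.arr aRow = s₂.arr aRow := hag.arr _ rfl
  by_cases hgk : g = k
  · subst hgk
    simp [hx, hn, ha, hrow, h2 (s.reg 1) le_rfl, hm₂]
  · simpa [hx, hgk] using ih g (by omega)

/-- Write the owners of the goods. -/
def reportCmd : Cmd := .for_ rGood 2 (.write (.cell aOwner (.reg rGood)))

theorem report_spec (s : State) :
    (reportCmd.exec s).out = s.out ++ (List.range (s.reg 2)).map s.owner := by
  refine exec_for_inv s (fun k s' => s'.out = s.out ++ (List.range k).map s.owner) (by simp) ?_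
  intro k s' hk hx hag ih
  have ho : s'.arr aOwner = s.arr aOwner := hag.arr _ rfl
  simp only [exec_write, State.setReg_out, Expr.eval_cell, Expr.eval_reg, hx, ho, ih]
  simp [List.range_succ]

/-- Decide whether the allocation is Pareto-optimal. -/
def decideCmd : Cmd := .seq loadCmd (.seq improveCmd (.write (.lit 1 - .reg rFlag)))

/-- Find a Pareto-optimal allocation that is at least as good for everybody. -/
def searchCmd : Cmd := .seq loadCmd (.seq optimizeCmd reportCmd)

/-- Put `n` and `m` into the registers `1` and `2` and run the program `c`. -/
def start (c : Cmd) : Prog :=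
  .seq (.assign 1 (.cell 0 (.lit 0))) (.seq (.assign 2 (.cell 0 (.lit 1))) c.compile)

end RAM

/-! ### The encoded input -/

namespace FairDivision

open BivaluedInstance

/-- The allocation as a function on `ℕ`. -/
def extend {I : BivaluedInstance} (X : I.Allocation) (g : ℕ) : ℕ :=
  if h : g < I.m then X ⟨g, h⟩ else 0

/-- The allocation that a valid function on `ℕ` describes. -/
def restrict {I : BivaluedInstance} {o : ℕ → ℕ} (h : ∀ g < I.m, o g < I.n) : I.Allocation :=
  fun g => ⟨o g, h g g.2⟩

/-- The table has the sizes, the ratios and the large goods of the input. -/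
structure IntegerRatioInput.Represents (q : IntegerRatioInput) (T : Table) : Prop where
  n : T.n = q.I.n
  m : T.m = q.I.m
  r : ∀ i : Fin q.I.n, T.r i = q.r i
  lg : ∀ (i : Fin q.I.n) (g : Fin q.I.m), T.lg i g ≠ 0 ↔ q.I.u i g = q.I.a i

namespace IntegerRatioInput

variable {q : IntegerRatioInput} {T : Table}

theorem two_le (q : IntegerRatioInput) (i : Fin q.I.n) : 2 ≤ q.r i := by
  have h := q.ratio i
  have hb := q.I.b_pos i
  have : (1 : ℝ) < q.r i := by
    rw [← h, lt_div_iff₀ hb, one_mul]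
    exact q.I.b_lt_a i
  exact_mod_cast this

theorem Represents.two_le (R : q.Represents T) : ∀ i < T.n, 2 ≤ T.r i := by
  intro i hi
  rw [R.n] at hi
  rw [R.r ⟨i, hi⟩]
  exact q.two_le _

/-- Utilities are the normalised utilities, in units of the value of a small good. -/
theorem Represents.utility (R : q.Represents T) (Y : q.I.Allocation) {o : ℕ → ℕ}
    (ho : ∀ g : Fin q.I.m, o g = Y g) (i : Fin q.I.n) :
    q.I.utility i (Allocation.bundle Y i) = q.I.b i * T.util o i := by
  have hval : ∀ g : Fin q.I.m, q.I.u i g = q.I.b i * T.val i g := by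
    intro g
    have hb := q.I.b_pos i
    by_cases h : T.lg i g = 0
    · have h' : ¬ q.I.u i g = q.I.a i := fun h' => (R.lg i g).2 h' h
      rw [Table.val, if_pos h, (q.I.bivalued i g).resolve_left h']
      simp
    · rw [Table.val, if_neg h, R.r, ← q.ratio i, (R.lg i g).1 h]
      field_simp
  rw [BivaluedInstance.utility, Allocation.bundle, Finset.sum_filter, Table.util, R.m,
    Finset.sum_range, Nat.cast_sum, Finset.mul_sum]
  refine Finset.sum_congr rfl fun g _ => ?_
  rw [ho g]
  by_cases h : Y g = i
  · simp [h, hval]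
  · rw [if_neg h, if_neg (fun h' => h (Fin.ext h'))]
    simp

theorem Represents.dominates_iff (R : q.Represents T) (Y X : q.I.Allocation) {o' o : ℕ → ℕ}
    (ho' : ∀ g : Fin q.I.m, o' g = Y g) (ho : ∀ g : Fin q.I.m, o g = X g) :
    Dominates Y X ↔ T.Dom o' o := by
  have hle : ∀ i, q.I.utility i (Allocation.bundle X i) ≤ q.I.utility i (Allocation.bundle Y i) ↔
      T.util o i ≤ T.util o' i := fun i => by
    rw [R.utility Y ho', R.utility X ho, mul_le_mul_iff_right₀ (q.I.b_pos i), Nat.cast_le]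
  have hlt : ∀ i, q.I.utility i (Allocation.bundle X i) < q.I.utility i (Allocation.bundle Y i) ↔
      T.util o i < T.util o' i := fun i => by
    rw [R.utility Y ho', R.utility X ho, mul_lt_mul_iff_right₀ (q.I.b_pos i), Nat.cast_lt]
  simp only [Dominates, Table.Dom, hle, hlt, R.n]
  refine and_congr ⟨fun h i hi => h ⟨i, hi⟩, fun h i => h i i.2⟩
    ⟨fun ⟨j, hj⟩ => ⟨j, j.2, hj⟩, fun ⟨j, hj, h⟩ => ⟨⟨j, hj⟩, h⟩⟩

theorem Represents.paretoOptimal_iff (R : q.Represents T) (X : q.I.Allocation) {o : ℕ → ℕ}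
    (ho : ∀ g : Fin q.I.m, o g = X g) : ParetoOptimal X ↔ T.Optimal o := by
  constructor
  · intro h o' hv hd
    have hv' : ∀ g < q.I.m, o' g < q.I.n := by
      intro g hg
      have := hv g (R.m ▸ hg)
      rwa [R.n] at this
    exact h ⟨restrict hv', (R.dominates_iff (restrict hv') X (fun _ => rfl) ho).2 hd⟩
  · rintro h ⟨Y, hY⟩
    have hY' : ∀ g : Fin q.I.m, extend Y g = Y g := fun g => by simp [extend]
    refine h (extend Y) (fun g hg => ?_) ((R.dominates_iff Y X hY' ho).1 hY)
    rw [R.m] at hg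
    rw [R.n]
    simp [extend, hg]

end IntegerRatioInput

theorem getD_ofFn {α : Type*} {n : ℕ} (f : Fin n → α) (d : α) (i : Fin n) :
    (List.ofFn f).getD i d = f i := by
  simp

theorem length_flatten_ofFn {α : Type*} {n m : ℕ} (f : Fin n → Fin m → α) :
    (List.ofFn fun i => List.ofFn (f i)).flatten.length = n * m := by
  rw [List.length_flatten, List.map_ofFn, List.sum_ofFn]
  simp

theorem getD_flatten_ofFn {α : Type*} {n m : ℕ} (f : Fin n → Fin m → α) (d : α) (i : Fin n)
    (j : Fin m) : (List.ofFn fun i => List.ofFn (f i)).flatten.getD (i * m + j) d = f i j := by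
  induction n with
  | zero => exact i.elim0
  | succ n ih =>
    rw [List.ofFn_succ, List.flatten_cons]
    refine Fin.cases ?_ (fun i => ?_) i
    · rw [List.getD_append _ _ _ _ (by simp)]
      simp
    · have hlen : (List.ofFn (f 0)).length = m := by simp
      have he : (i.succ : ℕ) * m + j = m + (i * m + j) := by
        rw [Fin.val_succ]; ring
      rw [he, List.getD_append_right _ _ _ _ (by omega), hlen, Nat.add_sub_cancel_left]
      exact ih (fun i => f i.succ) i

namespace IntegerRatioInput

variable (q : IntegerRatioInput)

open Classical in
theorem encode_eq : q.encode = q.I.n :: q.I.m :: (List.ofFn q.r ++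
    ((List.ofFn fun i => List.ofFn fun g => if q.I.u i g = q.I.a i then 1 else 0).flatten ++
      encodeAllocation q.X)) := by
  simp [encode]

theorem length_encode : q.encode.length = 2 + q.I.n + q.I.n * q.I.m + q.I.m := by
  rw [encode_eq, List.length_cons, List.length_cons, List.length_append, List.length_append,
    length_flatten_ofFn, encodeAllocation, List.length_ofFn, List.length_ofFn]
  omega

theorem encode_zero : q.encode.getD 0 0 = q.I.n := by simp [encode_eq]

theorem encode_one : q.encode.getD 1 0 = q.I.m := by simp [encode_eq]

theorem encode_ratio (i : Fin q.I.n) : q.encode.getD (2 + i) 0 = q.r i := by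
  rw [encode_eq, show 2 + (i : ℕ) = i + 1 + 1 by ring, List.getD_cons_succ, List.getD_cons_succ,
    List.getD_append _ _ _ _ (by simp), getD_ofFn]

open Classical in
theorem encode_large (i : Fin q.I.n) (g : Fin q.I.m) :
    q.encode.getD (2 + q.I.n + i * q.I.m + g) 0 = if q.I.u i g = q.I.a i then 1 else 0 := by
  have hlt : (i : ℕ) * q.I.m + g < q.I.n * q.I.m := by
    have := Nat.mul_le_mul_right q.I.m (Nat.succ_le_of_lt i.2)
    rw [Nat.succ_mul] at this
    omega
  rw [encode_eq, show 2 + q.I.n + i * q.I.m + g = q.I.n + (i * q.I.m + g) + 1 + 1 by ring,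
    List.getD_cons_succ, List.getD_cons_succ, List.getD_append_right _ _ _ _ (by simp),
    List.length_ofFn, Nat.add_sub_cancel_left,
    List.getD_append _ _ _ _ (by rw [length_flatten_ofFn]; exact hlt), getD_flatten_ofFn]

theorem encode_owner (g : Fin q.I.m) :
    q.encode.getD (2 + q.I.n + q.I.n * q.I.m + g) 0 = q.X g := by
  rw [encode_eq, show 2 + q.I.n + q.I.n * q.I.m + g = q.I.n + (q.I.n * q.I.m + g) + 1 + 1 by ring,
    List.getD_cons_succ, List.getD_cons_succ, List.getD_append_right _ _ _ _ (by simp),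
    List.length_ofFn, Nat.add_sub_cancel_left,
    List.getD_append_right _ _ _ _ (by rw [length_flatten_ofFn]; omega), length_flatten_ofFn,
    Nat.add_sub_cancel_left, encodeAllocation, getD_ofFn]

end IntegerRatioInput
end FairDivision

namespace RAM

open FairDivision Cmd

/-- The state after reading `n` and `m`. -/
noncomputable def inputState (q : IntegerRatioInput) : State :=
  ((init q.encode).setReg 1 q.I.n).setReg 2 q.I.m

/-- The state after loading the input. -/
noncomputable def loaded (q : IntegerRatioInput) : State := loadCmd.exec (inputState q)

variable (q : IntegerRatioInput)

theorem loaded_reg (z : ℕ) (hz : loadCmd.writesReg z = false) :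
    (loaded q).reg z = (inputState q).reg z := (loadCmd.exec_agree _).reg z hz

theorem loaded_represents : q.Represents (loaded q).table := by
  have ha : (loaded q).arr 0 = (inputState q).arr 0 := (loadCmd.exec_agree _).arr 0 rfl
  have hw : ∀ k, (inputState q).arr 0 k = q.encode.getD k 0 := fun k => rfl
  refine ⟨?_, ?_, fun i => ?_, fun i g => ?_⟩
  · rw [State.table_n, loaded_reg q 1 rfl]; simp [inputState]
  · rw [State.table_m, loaded_reg q 2 rfl]; simp [inputState]
  · change (loaded q).arr 0 (2 + i) = _
    rw [ha, hw, q.encode_ratio]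
  · change (loaded q).arr 0 ((loaded q).arr aRow i + g) ≠ 0 ↔ _
    have hrow := (load_spec (inputState q)).1 i (by simp [inputState])
    have : (loaded q).arr aRow i = 2 + q.I.n + i * q.I.m := by
      rw [loaded, hrow]; simp [inputState]
    rw [ha, hw, this, q.encode_large]
    simp

theorem loaded_owner (g : Fin q.I.m) : (loaded q).owner g = q.X g := by
  have h := (load_spec (inputState q)).2 g (by simp [inputState])
  have hw : ∀ k, (inputState q).arr 0 k = q.encode.getD k 0 := fun k => rfl
  rw [loaded, h, hw, ← q.encode_owner]
  simp [inputState]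

theorem loaded_valid : (loaded q).table.Valid (loaded q).owner := by
  intro g hg
  rw [(loaded_represents q).m] at hg
  rw [loaded_owner q ⟨g, hg⟩, (loaded_represents q).n]
  exact (q.X ⟨g, hg⟩).2

theorem loaded_sizes : (loaded q).reg 1 + (loaded q).reg 2 + 2 ≤ (loaded q).reg 0 := by
  rw [loaded_reg q 0 rfl, loaded_reg q 1 rfl, loaded_reg q 2 rfl]
  have := q.length_encode
  simp [inputState, init]
  omega

/-- A program started on the encoded input runs in polynomial time. -/
theorem run_start (c : Cmd) (hc : c.ok = true) : ∃ t, Run (start c) (init q.encode) t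
    (c.exec (inputState q)) ∧ t ≤ (c.bound + Polynomial.C 6).eval (bitSize q.encode) := by
  have hlen := q.length_encode
  have h0 : (inputState q).reg 0 = q.encode.length := by simp [inputState, init]
  obtain ⟨t, ht, hb⟩ := run_compile c hc (inputState q) (fun y hy => by
    rw [h0]
    interval_cases y <;> simp [inputState, init] <;> omega)
  have h1 := Run.assign 1 (.cell 0 (.lit 0)) (init q.encode)
  have h2 := Run.assign 2 (.cell 0 (.lit 1)) ((init q.encode).setReg 1 q.I.n)
  have e1 : Expr.eval (init q.encode) (.cell 0 (.lit 0)) = q.I.n := q.encode_zero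
  have e2 : Expr.eval ((init q.encode).setReg 1 q.I.n) (.cell 0 (.lit 1)) = q.I.m := q.encode_one
  rw [e1] at h1
  rw [e2] at h2
  refine ⟨_, .seq h1 (.seq h2 ht), ?_⟩
  rw [h0] at hb
  have hmono : ∀ P : Polynomial ℕ, P.eval q.encode.length ≤ P.eval (bitSize q.encode) := by
    intro P
    simp only [Polynomial.eval_eq_sum, Polynomial.sum]
    exact Finset.sum_le_sum fun i _ => Nat.mul_le_mul_left _
      (Nat.pow_le_pow_left (length_le_bitSize _) _)
  have := hmono c.bound
  simp only [Polynomial.eval_add, Polynomial.eval_C, Expr.cost]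
  omega

end RAM

open FairDivision FairDivision.BivaluedInstance in
theorem corollary1 :
    RAM.DecidableInPolyTime IntegerRatioInput.encode
      (fun q : IntegerRatioInput => ParetoOptimal q.X) ∧
    RAM.SolvableInPolyTime
      (fun q : {q : IntegerRatioInput // ¬ ParetoOptimal q.X} => q.1.encode)
      (fun q w => ∃ Y : q.1.I.Allocation,
        ParetoOptimal Y ∧ Dominates Y q.1.X ∧ w = encodeAllocation Y) := by
  constructor
  · refine ⟨RAM.start RAM.decideCmd, RAM.decideCmd.bound + Polynomial.C 6, fun q => ?_⟩
    obtain ⟨t, ht, hb⟩ := RAM.run_start q RAM.decideCmd rfl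
    refine ⟨t, _, ht, hb, ?_⟩
    have R := RAM.loaded_represents q
    have hout : (RAM.decideCmd.exec (RAM.inputState q)).out =
        [1 - (RAM.improveCmd.exec (RAM.loaded q)).reg rFlag] := by
      have : (RAM.improveCmd.exec (RAM.loaded q)).out = [] :=
        ((RAM.improveCmd.exec_agree _).out rfl).trans ((RAM.loadCmd.exec_agree _).out rfl)
      simp only [RAM.decideCmd, RAM.Cmd.exec_seq, RAM.Cmd.exec_write]
      rw [← RAM.loaded, this]
      simp
    have hsz := RAM.loaded_sizes q
    have hflag : (RAM.loaded q).reg rFlag = 0 := RAM.loaded_reg q rFlag rfl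
    have hiff := R.paretoOptimal_iff q.X (RAM.loaded_owner q)
    rw [hout]
    beta_reduce
    rcases RAM.improve_spec (RAM.loaded q) (by omega) (fun i hi => R.two_le i hi)
      (RAM.loaded_valid q) with ⟨_, h, hopt⟩ | ⟨h, hv, hd⟩
    · rw [h, hflag, if_pos (hiff.2 hopt)]
    · rw [h, if_neg fun hopt => hiff.1 hopt _ hv hd]
  · refine ⟨RAM.start RAM.searchCmd, RAM.searchCmd.bound + Polynomial.C 6, fun ⟨q, hq⟩ => ?_⟩
    obtain ⟨t, ht, hb⟩ := RAM.run_start q RAM.searchCmd rfl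
    refine ⟨t, _, ht, hb, ?_⟩
    have R := RAM.loaded_represents q
    obtain ⟨hv, hopt, hd⟩ := RAM.optimize_spec (RAM.loaded q) (RAM.loaded_sizes q)
      (fun i hi => R.two_le i hi) (RAM.loaded_valid q)
    rw [R.paretoOptimal_iff q.X (RAM.loaded_owner q)] at hq
    set s := RAM.optimizeCmd.exec (RAM.loaded q) with hs
    have hd' := hd.resolve_left fun h => hq (h ▸ hopt)
    have hv' : ∀ g < q.I.m, s.owner g < q.I.n := by
      intro g hg
      have := hv g (R.m ▸ hg)
      rwa [R.n] at this
    refine ⟨restrict hv', (R.paretoOptimal_iff _ fun _ => rfl).2 hopt,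
      (R.dominates_iff _ _ (fun _ => rfl) (RAM.loaded_owner q)).2 hd', ?_⟩
    have hout : (RAM.searchCmd.exec (RAM.inputState q)).out = (RAM.reportCmd.exec s).out := rfl
    have hnil : s.out = [] :=
      ((RAM.optimizeCmd.exec_agree _).out rfl).trans ((RAM.loadCmd.exec_agree _).out rfl)
    have hm : s.reg 2 = q.I.m := ((RAM.optimizeCmd.exec_agree _).reg 2 rfl).trans R.m
    rw [hout, RAM.report_spec, hnil, hm, encodeAllocation, List.nil_append]
    refine List.ext_getElem (by simp) fun i _ _ => ?_
    simp [restrict]
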